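/- Conventions. Graphs are finite, simple and connected, with vertex set $V=\{0,\dots,n-1\}$, and every edge $e$ has a length $\ell(e)\ge 0$. For such a graph $G=(V,E)$ let $d_G$ be its shortest-path distance and $M_G=(V,d_G)$. The convex closure $\mathrm{conv}(G)$ consists of $V$ and of the interior points $e[x]$ ($e=\{u,v\}\in E$, $u<v$, $0<x<\ell(e)$), obtained by regarding each edge $e$ as a continuous segment of length $\ell(e)$, where $e[x]$ is the point at distance $x$ from $u$ along $e$; its distance is the induced length of a shortest connection: for $e=\{u,v\}$ and $e'=\{u',v'\}$ with $u<v$, $u'<v'$, the distance of $e[x]$ and $e'[y]$ is the least of $x+d_G(u,u')+y$, $x+d_G(u,v')+(\ell(e')-y)$, $(\ell(e)-x)+d_G(v,u')+y$, $(\ell(e)-x)+d_G(v,v')+(\ell(e')-y)$ and, if $e=e'$, also $|x-y|$; the distance of $e[x]$ and a vertex $w$ is $\min\{x+d_G(u,w),(\ell(e)-x)+d_G(v,w)\}$; and the distance of two vertices is $d_G$. The doubling dimension $\dim(X,d)$ is $\log_2\lambda$ for the least integer $\lambda$ such that, for all $x\in X$ and $r\ge 0$, the open ball $B(x,2r)$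 is covered by at most $\lambda$ open balls of radius $r$ with centres in $X$ (and $\infty$ if there is no such $\lambda$). Running times are those of a real RAM: a program has arrays of natural numbers (used as indices) and of real numbers, and can add and subtract natural numbers, add, subtract, multiply and divide real numbers exactly, and compare, each at unit cost; it has no rounding and no real constants other than natural numbers. Theorem. There are a real RAM program, a polynomial $p$ and a constant $C$ such that for every $n$, every connected graph $G=(V,E)$ on $V=\{0,\dots,n-1\}$ with nonnegative edge lengths, and every real $0<\varepsilon\le\frac12$, the program, given $G$ (as an adjacency matrix with the edge lengths) and $\varepsilon$, halts after at most $p(n)$ steps and outputs a connected graph $G'=(V,E')$ with nonnegative edge lengths such that 1. $d_G(u,v)\le d_{G'}(u,v)\le(1+\varepsilon)\,d_G(u,v)$ for all $u,v\in V$; and 2. if $\dim(M_G)=k$, then $\dim(M_{G'})\le C\,k$ and $\dim(\mathrm{conv}(G'))\le C\,k\,\log_2(1/\varepsilon)$. -/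

import Mathlib

/-! ### Graphs with edge lengths, shortest-path distances and the convex closure -/

/-- A simple graph together with a nonnegative length for every edge.  The values of `len` at
pairs that are not adjacent carry no information. -/
structure LengthGraph (V : Type*) where
  graph : SimpleGraph V
  len : V → V → ℝ
  len_symm : ∀ u v, graph.Adj u v → len u v = len v u
  len_nonneg : ∀ u v, graph.Adj u v → 0 ≤ len u v

namespace LengthGraph

/-- The total length of a walk. -/
def walkLength {V : Type*} (G : LengthGraph V) {u v : V} (w : G.graph.Walk u v) : ℝ :=
  (w.darts.map fun a => G.len a.fst a.snd).sum

/-- The shortest-path distance `d_G` (meaningful when `u` and `v` are connected). -/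
noncomputable def dist {V : Type*} (G : LengthGraph V) (u v : V) : ℝ :=
  ⨅ w : G.graph.Walk u v, G.walkLength w

/-- The interior points `e[x]` of the edges: `e = {u, v}` with `u < v`, at distance `x` from `u`
along the edge, where `0 < x < ℓ(e)`. -/
structure EdgePoint {V : Type*} [LT V] (G : LengthGraph V) where
  u : V
  v : V
  lt : u < v
  adj : G.graph.Adj u v
  x : ℝ
  x_pos : 0 < x
  x_lt : x < G.len u v

/-- The points of the convex closure: the vertices and the interior points of the edges. -/
inductive ConvPoint {V : Type*} [LT V] (G : LengthGraph V) where
  | vertex (w : V) : ConvPoint G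
  | edge (p : EdgePoint G) : ConvPoint G

/-- The distance from an interior point of an edge to a vertex. -/
noncomputable def edgeVertexDist {V : Type*} [LT V] (G : LengthGraph V) (p : EdgePoint G)
    (w : V) : ℝ :=
  min (p.x + G.dist p.u w) ((G.len p.u p.v - p.x) + G.dist p.v w)

/-- The length of a shortest connection of two interior points of edges that passes through an
endpoint of the edge of each. -/
noncomputable def edgeEdgeDist {V : Type*} [LT V] (G : LengthGraph V) (p q : EdgePoint G) : ℝ :=
  min
    (min (p.x + G.dist p.u q.u + q.x)
      (p.x + G.dist p.u q.v + (G.len q.u q.v - q.x)))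
    (min ((G.len p.u p.v - p.x) + G.dist p.v q.u + q.x)
      ((G.len p.u p.v - p.x) + G.dist p.v q.v + (G.len q.u q.v - q.x)))

open Classical in
/-- The distance of the convex closure.  Two points of the same edge may also be joined along that
edge. -/
noncomputable def convDist {V : Type*} [LT V] (G : LengthGraph V) :
    ConvPoint G → ConvPoint G → ℝ
  | .vertex w, .vertex w' => G.dist w w'
  | .vertex w, .edge q => G.edgeVertexDist q w
  | .edge p, .vertex w => G.edgeVertexDist p w
  | .edge p, .edge q =>
      if p.u = q.u ∧ p.v = q.v then min |p.x - q.x| (G.edgeEdgeDist p q)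
      else G.edgeEdgeDist p q

end LengthGraph

/-! ### Doubling dimension -/

/-- Every (open) ball of radius `2 r` is covered by at most `N` balls of radius `r`. -/
def HasDoublingConstant {X : Type*} (d : X → X → ℝ) (N : ℕ) : Prop :=
  ∀ (x : X) (r : ℝ), 0 ≤ r → ∃ S : Finset X, S.card ≤ N ∧
    ∀ z : X, d x z < 2 * r → ∃ y ∈ S, d y z < r

/-- The doubling dimension: `log₂` of the least doubling constant, and `⊤` if there is none. -/
noncomputable def doublingDim {X : Type*} (d : X → X → ℝ) : EReal :=
  ⨅ (N : ℕ) (_ : HasDoublingConstant d N), ((Real.logb 2 (N : ℝ) : ℝ) : EReal)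

/-! ### Real random access machines

The memory consists of two-dimensional arrays, numbered by natural numbers, of natural numbers
(used as indices, counters and flags) and of real numbers.  A program is a fixed finite object; it
can address cells through computed indices, it adds and subtracts natural numbers, performs exact
field operations on real numbers, and compares.  Rounding, logarithms and real constants other than
natural numbers are not available.  Every symbol that is evaluated costs one step. -/

namespace RealRAM

/-- A memory: `nats a i j` and `reals a i j` are the cells `(i, j)` of the arrays numbered `a`. -/
structure Mem where
  nats : ℕ → ℕ → ℕ → ℕ
  reals : ℕ → ℕ → ℕ → ℝ

/-- Expressions for natural numbers; `sub` is truncated subtraction. -/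
inductive NExp where
  | const (c : ℕ) : NExp
  | read (a : ℕ) (i j : NExp) : NExp
  | add (e f : NExp) : NExp
  | sub (e f : NExp) : NExp

/-- Expressions for real numbers; division by zero returns zero. -/
inductive RExp where
  | const (c : ℕ) : RExp
  | read (a : ℕ) (i j : NExp) : RExp
  | add (e f : RExp) : RExp
  | sub (e f : RExp) : RExp
  | mul (e f : RExp) : RExp
  | div (e f : RExp) : RExp

/-- Tests. -/
inductive Test where
  | natLT (e f : NExp) : Test
  | realLT (e f : RExp) : Test
  | not (b : Test) : Test
  | and (b c : Test) : Test

/-- Programs. -/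
inductive Prog where
  | skip : Prog
  | setNat (a : ℕ) (i j : NExp) (e : NExp) : Prog
  | setReal (a : ℕ) (i j : NExp) (e : RExp) : Prog
  | seq (P Q : Prog) : Prog
  | ite (b : Test) (P Q : Prog) : Prog
  | loop (b : Test) (P : Prog) : Prog

/-- The value of an expression. -/
def NExp.eval (m : Mem) : NExp → ℕ
  | .const c => c
  | .read a i j => m.nats a (i.eval m) (j.eval m)
  | .add e f => e.eval m + f.eval m
  | .sub e f => e.eval m - f.eval m

/-- The value of an expression. -/
noncomputable def RExp.eval (m : Mem) : RExp → ℝ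
  | .const c => (c : ℝ)
  | .read a i j => m.reals a (i.eval m) (j.eval m)
  | .add e f => e.eval m + f.eval m
  | .sub e f => e.eval m - f.eval m
  | .mul e f => e.eval m * f.eval m
  | .div e f => e.eval m / f.eval m

/-- A test is passed. -/
def Test.Holds (m : Mem) : Test → Prop
  | .natLT e f => e.eval m < f.eval m
  | .realLT e f => e.eval m < f.eval m
  | .not b => ¬ b.Holds m
  | .and b c => b.Holds m ∧ c.Holds m

/-- The number of steps that an evaluation takes. -/
def NExp.cost : NExp → ℕ
  | .const _ => 1
  | .read _ i j => i.cost + j.cost + 1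
  | .add e f => e.cost + f.cost + 1
  | .sub e f => e.cost + f.cost + 1

/-- The number of steps that an evaluation takes. -/
def RExp.cost : RExp → ℕ
  | .const _ => 1
  | .read _ i j => i.cost + j.cost + 1
  | .add e f => e.cost + f.cost + 1
  | .sub e f => e.cost + f.cost + 1
  | .mul e f => e.cost + f.cost + 1
  | .div e f => e.cost + f.cost + 1

/-- The number of steps that a test takes. -/
def Test.cost : Test → ℕ
  | .natLT e f => e.cost + f.cost + 1
  | .realLT e f => e.cost + f.cost + 1
  | .not b => b.cost + 1
  | .and b c => b.cost + c.cost + 1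

/-- Overwrite one cell of an array of natural numbers. -/
def Mem.writeNat (m : Mem) (a i j c : ℕ) : Mem where
  nats := fun a' i' j' => if a' = a ∧ i' = i ∧ j' = j then c else m.nats a' i' j'
  reals := m.reals

/-- Overwrite one cell of an array of real numbers. -/
def Mem.writeReal (m : Mem) (a i j : ℕ) (c : ℝ) : Mem where
  nats := m.nats
  reals := fun a' i' j' => if a' = a ∧ i' = i ∧ j' = j then c else m.reals a' i' j'

/-- `Exec P m t m'`: started in the memory `m`, the program `P` halts after exactly `t` steps in the
memory `m'`. -/
inductive Exec : Prog → Mem → ℕ → Mem → Prop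
  | skip (m : Mem) : Exec .skip m 1 m
  | setNat (m : Mem) (a : ℕ) (i j e : NExp) :
      Exec (.setNat a i j e) m (i.cost + j.cost + e.cost + 1)
        (m.writeNat a (i.eval m) (j.eval m) (e.eval m))
  | setReal (m : Mem) (a : ℕ) (i j : NExp) (e : RExp) :
      Exec (.setReal a i j e) m (i.cost + j.cost + e.cost + 1)
        (m.writeReal a (i.eval m) (j.eval m) (e.eval m))
  | seq {P Q : Prog} {m m' m'' : Mem} {s t : ℕ} :
      Exec P m s m' → Exec Q m' t m'' → Exec (.seq P Q) m (s + t) m''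
  | iteTrue {b : Test} {P Q : Prog} {m m' : Mem} {t : ℕ} :
      b.Holds m → Exec P m t m' → Exec (.ite b P Q) m (b.cost + t) m'
  | iteFalse {b : Test} {P Q : Prog} {m m' : Mem} {t : ℕ} :
      ¬ b.Holds m → Exec Q m t m' → Exec (.ite b P Q) m (b.cost + t) m'
  | loopStop {b : Test} {P : Prog} {m : Mem} :
      ¬ b.Holds m → Exec (.loop b P) m b.cost m
  | loopStep {b : Test} {P : Prog} {m m' m'' : Mem} {s t : ℕ} :
      b.Holds m → Exec P m s m' → Exec (.loop b P) m' t m'' →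
      Exec (.loop b P) m (b.cost + s + t) m''

open Classical in
/-- The initial memory on input `(G, ε)`.  Natural numbers: array `0` holds the number `n` of
vertices in its cell `(0, 0)`, array `1` the adjacency matrix of `G`.  Real numbers: array `0` holds
`ε` in its cell `(0, 0)`, array `1` the edge lengths.  All the other cells are zero. -/
noncomputable def inputMem {n : ℕ} (G : LengthGraph (Fin n)) (ε : ℝ) : Mem where
  nats := fun a i j =>
    if a = 0 ∧ i = 0 ∧ j = 0 then n
    else if a = 1 ∧ ∃ (hi : i < n) (hj : j < n), G.graph.Adj ⟨i, hi⟩ ⟨j, hj⟩ then 1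
    else 0
  reals := fun a i j =>
    if a = 0 ∧ i = 0 ∧ j = 0 then ε
    else if h : a = 1 ∧ ∃ (hi : i < n) (hj : j < n), G.graph.Adj ⟨i, hi⟩ ⟨j, hj⟩ then
      G.len ⟨i, h.2.choose⟩ ⟨j, h.2.choose_spec.choose⟩
    else 0

/-- The memory holds the graph `H` as output: its adjacency matrix in the array `2` of natural
numbers and its edge lengths in the array `2` of real numbers. -/
def HoldsOutput {n : ℕ} (m : Mem) (H : LengthGraph (Fin n)) : Prop :=
  ∀ u v : Fin n, (m.nats 2 u v = 1 ↔ H.graph.Adj u v) ∧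
    (H.graph.Adj u v → m.reals 2 u v = H.len u v)

end RealRAM

/-! Write d for the distance of G and T = 100/ε. A farthest point traversal of (V, d) gives every
vertex b a radius R b such that, for all scales s at once, the vertices of radius at least s form an
s-net. Real radii replace a hierarchy of nets at powers of two, so no rounding is needed. Link b to
every a with R b ≤ R a and d(a, b) ≤ T·R b. These links already form a (1+ε)-spanner: from u and v
climb to vertices of radius about d(u, v)/T, at the cost of a geometric series; the two vertices
reached are close enough to be linked (`stretch_of_linked`).

Such a spanner has a doubling vertex metric, but its convex closure needs more: only few edges of
length at least r may start in a ball of radius 2r, as each of them may need its own balls. A vertex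
a of large radius violates this, since it receives links from all the scales below its own. So the
link of b to a is rerouted to a representative: a vertex q with d(a, q) ≤ T·R q and R q < R b/T², of
largest radius among these (a itself if there is none). Then d(a, q) < R b/T, so the detour is
cheap, and q is itself linked to a at a smaller scale, so that a short path from a to q exists by
induction (`exists_walk_of_linked`). On the other hand, links to the same a with the same
representative have radii within a factor T² of each other, for otherwise the lower link would have
supplied a better representative to the upper one. With packing bounds this leaves N^O(log T) long
edges at a ball, where N is the doubling constant of d (`card_linkGraph_long_edges_le`). A net of
vertices together with a few points on the long edges then covers balls of the closure
(`LengthGraph.hasDoublingConstant_convDist`), and logarithms give O(k log(1/ε)).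

The program carries out this construction by exhaustive search. All its loops are counted up to n,
so its running time is a polynomial read off from its syntax, and its correctness is proved with
loop invariants. -/

namespace LengthGraph

/-! ### Shortest-path distances -/

section Dist

variable {V : Type*} (G : LengthGraph V)

theorem walkLength_nil (u : V) : G.walkLength (SimpleGraph.Walk.nil : G.graph.Walk u u) = 0 := rfl

theorem walkLength_cons {u v w : V} (h : G.graph.Adj u v) (p : G.graph.Walk v w) :
    G.walkLength (SimpleGraph.Walk.cons h p) = G.len u v + G.walkLength p := by
  simp [walkLength]

theorem walkLength_append {u v w : V} (p : G.graph.Walk u v) (q : G.graph.Walk v w) :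
    G.walkLength (p.append q) = G.walkLength p + G.walkLength q := by
  simp [walkLength]

theorem walkLength_reverse {u v : V} (p : G.graph.Walk u v) :
    G.walkLength p.reverse = G.walkLength p := by
  induction p with
  | nil => rfl
  | cons h p ih =>
    rw [SimpleGraph.Walk.reverse_cons, walkLength_append, ih, walkLength_cons, walkLength_cons,
      walkLength_nil, G.len_symm _ _ h]
    ring

theorem walkLength_nonneg {u v : V} (p : G.graph.Walk u v) : 0 ≤ G.walkLength p := by
  apply List.sum_nonneg
  intro x hx
  obtain ⟨a, -, rfl⟩ := List.mem_map.1 hx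
  exact G.len_nonneg _ _ a.adj

theorem bddBelow_walkLength (u v : V) :
    BddBelow (Set.range fun w : G.graph.Walk u v => G.walkLength w) :=
  ⟨0, by rintro _ ⟨w, rfl⟩; exact G.walkLength_nonneg w⟩

theorem dist_le_walkLength {u v : V} (p : G.graph.Walk u v) : G.dist u v ≤ G.walkLength p :=
  ciInf_le (G.bddBelow_walkLength u v) p

theorem dist_nonneg (u v : V) : 0 ≤ G.dist u v :=
  Real.iInf_nonneg fun w => G.walkLength_nonneg w

theorem dist_self (u : V) : G.dist u u = 0 :=
  le_antisymm (G.dist_le_walkLength SimpleGraph.Walk.nil) (G.dist_nonneg u u)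

theorem dist_le_len {u v : V} (h : G.graph.Adj u v) : G.dist u v ≤ G.len u v := by
  simpa [walkLength] using G.dist_le_walkLength (SimpleGraph.Walk.cons h SimpleGraph.Walk.nil)

variable {G}

theorem le_dist (hG : G.graph.Connected) {u v : V} {c : ℝ}
    (h : ∀ w : G.graph.Walk u v, c ≤ G.walkLength w) : c ≤ G.dist u v := by
  have : Nonempty (G.graph.Walk u v) := hG.preconnected u v
  exact le_ciInf h

theorem dist_comm (hG : G.graph.Connected) (u v : V) : G.dist u v = G.dist v u := by
  apply le_antisymm <;> refine le_dist hG fun w => ?_ <;> rw [← walkLength_reverse] <;>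
    exact G.dist_le_walkLength _

theorem dist_triangle (hG : G.graph.Connected) (u v w : V) :
    G.dist u w ≤ G.dist u v + G.dist v w := by
  rw [← sub_le_iff_le_add]
  refine le_dist hG fun p => ?_
  rw [sub_le_comm]
  refine le_dist hG fun q => ?_
  rw [sub_le_iff_le_add', ← walkLength_append]
  exact G.dist_le_walkLength _

/-- A function that satisfies the triangle inequality along edges and is bounded by the edge
lengths is bounded by the lengths of walks. -/
theorem le_dist_of_triangle (hG : G.graph.Connected) {D : V → V → ℝ} (h0 : ∀ u, D u u = 0)
    (ht : ∀ u v w, D u w ≤ D u v + D v w) (hl : ∀ u v, G.graph.Adj u v → D u v ≤ G.len u v)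
    (u v : V) : D u v ≤ G.dist u v := by
  refine le_dist hG fun p => ?_
  induction p with
  | nil => rw [h0, walkLength_nil]
  | cons h p ih =>
    rw [walkLength_cons]
    exact (ht _ _ _).trans (add_le_add (hl _ _ h) ih)

theorem exists_walk_length_lt [Fintype V] {u v : V} (p : G.graph.Walk u v) :
    ∃ q : G.graph.Walk u v, q.length < Fintype.card V ∧ G.walkLength q ≤ G.walkLength p := by
  classical
  refine ⟨p.bypass, p.bypass_isPath.length_lt, ?_⟩
  refine List.Sublist.sum_le_sum (p.darts_bypass_sublist_darts.map _) ?_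
  intro x hx
  obtain ⟨a, -, rfl⟩ := List.mem_map.1 hx
  exact G.len_nonneg _ _ a.adj

open Classical in
/-- The edge lengths, extended by zero. -/
noncomputable def weight (G : LengthGraph V) (u v : V) : ℝ :=
  if G.graph.Adj u v then G.len u v else 0

theorem weight_nonneg (u v : V) : 0 ≤ G.weight u v := by
  unfold weight
  split_ifs with h
  exacts [G.len_nonneg _ _ h, le_rfl]

theorem len_eq_weight {u v : V} (h : G.graph.Adj u v) : G.len u v = G.weight u v := by
  simp [weight, h]

/-- A path uses every dart at most once. The bound serves the machine as a substitute for infinity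
that needs only additions. -/
theorem dist_le_sum_weight [Fintype V] (hG : G.graph.Connected) (u v : V) :
    G.dist u v ≤ ∑ a, ∑ b, G.weight a b := by
  classical
  obtain ⟨p⟩ := hG.preconnected u v
  refine (G.dist_le_walkLength p.bypass).trans ?_
  have hnd : (p.bypass.darts.map fun a => (a.fst, a.snd)).Nodup := by
    apply List.Nodup.map
    · intro a b h
      exact SimpleGraph.Dart.ext _ _ h
    · exact SimpleGraph.Walk.darts_nodup_of_support_nodup p.bypass_isPath.support_nodup
  have h1 : G.walkLength p.bypass =
      ((p.bypass.darts.map fun a => (a.fst, a.snd)).map fun x => G.weight x.1 x.2).sum := by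
    rw [walkLength, List.map_map]
    congr 1
    apply List.map_congr_left
    intro a _
    exact len_eq_weight a.adj
  rw [h1, ← List.sum_toFinset _ hnd, ← Fintype.sum_prod_type']
  exact Finset.sum_le_sum_of_subset_of_nonneg (Finset.subset_univ _)
    fun x _ _ => weight_nonneg x.1 x.2

end Dist

end LengthGraph

/-! ### Pseudometrics, net radii and the link graph -/

/-- A nonnegative symmetric function that vanishes on the diagonal and satisfies the triangle
inequality. -/
structure IsPseudoDist {V : Type*} (d : V → V → ℝ) : Prop where
  self : ∀ u, d u u = 0
  comm : ∀ u v, d u v = d v u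
  triangle : ∀ u v w, d u w ≤ d u v + d v w

theorem IsPseudoDist.nonneg {V : Type*} {d : V → V → ℝ} (hd : IsPseudoDist d) (u v : V) :
    0 ≤ d u v := by
  have h1 := hd.triangle u v u
  have h2 := hd.self u
  have h3 := hd.comm u v
  linarith

theorem LengthGraph.isPseudoDist_dist {V : Type*} {G : LengthGraph V} (hG : G.graph.Connected) :
    IsPseudoDist G.dist :=
  ⟨G.dist_self, G.dist_comm hG, G.dist_triangle hG⟩

/-- Radii of points such that, for every scale `s` up to `B`, the points of radius at least `s`
form an `s`-net. -/
structure IsNetRadius {V : Type*} (d : V → V → ℝ) (R : V → ℝ) (B : ℝ) : Prop where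
  nonneg : ∀ v, 0 ≤ R v
  sep : ∀ u v, u ≠ v → min (R u) (R v) ≤ d u v
  cover : ∀ s, 0 < s → s ≤ B → ∀ v, ∃ u, s ≤ R u ∧ d u v < s

/-- The point `b` is to be linked to the point `a` of the net at the scale of `b`. -/
def Linked {V : Type*} (d : V → V → ℝ) (R : V → ℝ) (T : ℝ) (a b : V) : Prop :=
  a ≠ b ∧ R b ≤ R a ∧ d a b ≤ T * R b

/-- The candidates for replacing `a` in the link of `b` to `a`. -/
def Substitute {V : Type*} (d : V → V → ℝ) (R : V → ℝ) (T : ℝ) (a b q : V) : Prop :=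
  q ≠ a ∧ d a q ≤ T * R q ∧ T ^ 2 * R q < R b

/-- The point `x` is a candidate of largest radius, or `a` if there are no candidates. -/
def IsRep {V : Type*} (d : V → V → ℝ) (R : V → ℝ) (T : ℝ) (a b x : V) : Prop :=
  (x = a ∧ ∀ q, ¬ Substitute d R T a b q) ∨
    (Substitute d R T a b x ∧ ∀ q, Substitute d R T a b q → R q ≤ R x)

/-- The graph in which every `b` is joined to the representatives of the points linked to it. -/
def linkGraph {V : Type*} {d : V → V → ℝ} (hd : IsPseudoDist d) (R : V → ℝ) (T : ℝ)
    (rep : V → V → V) : LengthGraph V where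
  graph :=
    { Adj := fun u v => u ≠ v ∧ ∃ a b, Linked d R T a b ∧
        ((u = rep a b ∧ v = b) ∨ (v = rep a b ∧ u = b))
      symm := ⟨fun _ _ ⟨h, a, b, hab, h'⟩ => ⟨h.symm, a, b, hab, h'.symm⟩⟩
      loopless := ⟨fun _ h => h.1 rfl⟩ }
  len := d
  len_symm := fun u v _ => hd.comm u v
  len_nonneg := fun u v _ => hd.nonneg u v

/-! ### The link graph is a connected spanner -/

section Stretch

variable {V : Type*} {d : V → V → ℝ} {R : V → ℝ} {B T : ℝ} {rep : V → V → V}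

/-- A candidate has radius strictly below `R b`, so rerouting never creates a loop. -/
theorem IsRep.ne {a b x : V} (hR : ∀ v, 0 ≤ R v) (hT : 1 ≤ T) (hl : Linked d R T a b)
    (hx : IsRep d R T a b x) : x ≠ b := by
  rcases hx with ⟨rfl, -⟩ | ⟨⟨-, -, h⟩, -⟩
  · exact hl.1
  · rintro rfl
    nlinarith [mul_nonneg (sub_nonneg.2 (one_le_pow₀ hT : 1 ≤ T ^ 2)) (hR x)]

/-- Combines `d a x ≤ T * R x` with `T ^ 2 * R x < R b`. This is what makes the detour through `x`
cheap. -/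
theorem IsRep.mul_dist_le {a b x : V} (hd : IsPseudoDist d) (hR : ∀ v, 0 ≤ R v) (hT : 1 ≤ T)
    (hx : IsRep d R T a b x) : T * d a x ≤ R b := by
  rcases hx with ⟨rfl, -⟩ | ⟨⟨-, h1, h2⟩, -⟩
  · simpa [hd.self] using hR b
  · nlinarith

/-- If linked pairs are joined by short paths, so are all pairs: the part of the stretch argument
that does not depend on how the links are realised. -/
theorem stretch_of_linked [Fintype V] {D : V → V → ℝ} (hd : IsPseudoDist d) (hD : IsPseudoDist D)
    (hdD : ∀ u v, d u v ≤ D u v)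
    (hR : IsNetRadius d R B) (hB : ∀ u v, d u v ≤ B) (hT : 200 ≤ T)
    (hl : ∀ a b, Linked d R T a b → D a b ≤ (1 + 3 / T) * d a b) (u v : V) :
    D u v ≤ (1 + 100 / T) * d u v := by
  have hT0 : 0 < T := by linarith
  have h3 : 3 / T ≤ 1 / 10 := by rw [div_le_iff₀ hT0]; linarith
  have h3' : 0 ≤ 3 / T := by positivity
  have hc : ∀ a b, a ≠ b → d a b ≤ T * min (R a) (R b) → D a b ≤ (1 + 3 / T) * d a b := by
    intro a b hab h
    rcases le_total (R b) (R a) with h' | h'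
    · exact hl a b ⟨hab, h', by rwa [min_eq_right h'] at h⟩
    · rw [hD.comm, hd.comm]
      exact hl b a ⟨hab.symm, h', by rwa [min_eq_left h', hd.comm] at h⟩
  -- A step from `u` costs at most `1.1 * (2 * R u)` and either reaches radius `s` or at least
  -- doubles the radius. The bound `4.4 * s - 2.2 * R u` is the geometric series in a form that
  -- telescopes. The induction is on the number of vertices of larger radius.
  have climb_pos : ∀ s, 0 < s → s ≤ B → ∀ (k : ℕ) u, 0 < R u →
      (Finset.univ.filter fun w => R u < R w).card = k →
      ∃ p, s ≤ R p ∧ (R u < s → D u p ≤ 4.4 * s - 2.2 * R u) ∧ (s ≤ R u → p = u) := by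
    intro s hs hsB k
    induction k using Nat.strong_induction_on with
    | _ k ih =>
      intro u hu hk
      by_cases hus : s ≤ R u
      · exact ⟨u, hus, fun h => absurd hus (not_le.2 h), fun _ => rfl⟩
      push Not at hus
      obtain ⟨p, hp, hpu⟩ := hR.cover (min (2 * R u) s) (lt_min (by linarith) hs)
        ((min_le_right _ _).trans hsB) u
      have hup : R u < R p := lt_of_lt_of_le (lt_min (by linarith) hus) hp
      have hne : u ≠ p := by rintro rfl; exact lt_irrefl _ hup
      have h2 : d u p < 2 * R u := by rw [hd.comm]; exact hpu.trans_le (min_le_left _ _)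
      have h2s : d u p < s := by rw [hd.comm]; exact hpu.trans_le (min_le_right _ _)
      have hDup := hc u p hne (by rw [min_eq_left hup.le]; nlinarith)
      have hdn := hd.nonneg u p
      have hDup' : D u p ≤ 1.1 * d u p := by nlinarith
      obtain ⟨p', hp', h1, h1'⟩ := ih _ (by
        rw [← hk]
        apply Finset.card_lt_card
        refine ⟨fun w hw => ?_, fun hsub => ?_⟩
        · simp only [Finset.mem_filter, Finset.mem_univ, true_and] at hw ⊢
          exact hup.trans hw
        · have := @hsub p (by simpa using hup)
          simp at this) p (hu.trans hup) rfl
      refine ⟨p', hp', fun _ => ?_, fun h => absurd h (not_le.2 hus)⟩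
      by_cases hps : s ≤ R p
      · rw [h1' hps]
        linarith
      · push Not at hps
        have h4 := h1 hps
        have h5 : 2 * R u ≤ R p := by
          rcases min_le_iff.1 hp with h | h
          · exact h
          · linarith
        have := hD.triangle u p p'
        linarith
  have climb : ∀ s, 0 < s → s ≤ B → ∀ u, ∃ p, s ≤ R p ∧ D u p ≤ 5 * s := by
    intro s hs hsB
    have hpos : ∀ u, 0 < R u → ∃ p, s ≤ R p ∧ D u p ≤ 5 * s := by
      intro u hu
      obtain ⟨p, hp, h1, h2⟩ := climb_pos s hs hsB _ u hu rfl
      refine ⟨p, hp, ?_⟩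
      by_cases hus : s ≤ R u
      · rw [h2 hus, hD.self]; linarith
      · push Not at hus
        linarith [h1 hus]
    intro u
    rcases (hR.nonneg u).eq_or_lt with hu | hu
    -- A vertex of radius zero lies at distance zero from some vertex of positive radius: otherwise
    -- the net at the scale of the distance to the nearest one would contain a nearer one. The two
    -- are then linked.
    · obtain ⟨p0, hp0, -⟩ := hR.cover s hs hsB u
      obtain ⟨p, hp, hmin⟩ := Finset.exists_min_image (Finset.univ.filter fun w => 0 < R w)
        (fun w => d w u) ⟨p0, by simpa using hs.trans_le hp0⟩
      simp only [Finset.mem_filter, Finset.mem_univ, true_and] at hp hmin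
      have hpu : d p u = 0 := by
        by_contra h
        have h' : 0 < d p u := lt_of_le_of_ne (hd.nonneg _ _) (Ne.symm h)
        obtain ⟨q, hq, hqu⟩ := hR.cover _ h' (hB _ _) u
        exact absurd (hmin q (h'.trans_le hq)) (not_le.2 hqu)
      obtain ⟨p', hp', h5⟩ := hpos p hp
      have hne : p ≠ u := by rintro rfl; linarith
      have h6 := hc p u hne (by rw [hpu, min_eq_right (by linarith), ← hu]; simp)
      rw [hpu, mul_zero, hD.comm] at h6
      exact ⟨p', hp', by linarith [hD.triangle u p p']⟩
    · exact hpos u hu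
  have hdn := hd.nonneg u v
  by_cases huv : u = v
  · subst huv; rw [hd.self, hD.self]; simp
  rcases hdn.eq_or_lt with h0 | h0
  · have := hc u v huv (by rw [← h0]; exact mul_nonneg hT0.le (le_min (hR.nonneg _) (hR.nonneg _)))
    rw [← h0] at this ⊢
    simpa using this
  -- At this scale the vertices `p`, `q` reached from `u`, `v` satisfy `d p q ≤ d u v + 10 * s ≤ T *
  -- s`, so they are linked in one order if distinct. The total excess is at most `22.5 * s`, while
  -- `50 * s` is allowed.
  set s := 2 * d u v / T with hs
  have hsT : s * T = 2 * d u v := by rw [hs]; field_simp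
  have hs0 : 0 < s := by positivity
  have hsd : s ≤ d u v := by nlinarith
  obtain ⟨p, hp, hup⟩ := climb s hs0 (hsd.trans (hB _ _)) u
  obtain ⟨q, hq, hvq⟩ := climb s hs0 (hsd.trans (hB _ _)) v
  have e1 : 100 / T * d u v = 50 * s := by rw [hs]; ring
  have e2 : 3 / T * d u v = 1.5 * s := by rw [hs]; ring
  have t1 := hD.triangle u p v
  have t2 := hD.triangle p q v
  have t3 := hD.comm q v
  rw [add_mul, e1, one_mul]
  by_cases hpq : p = q
  · subst hpq
    linarith
  · have t4 := hd.triangle p u q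
    have t5 := hd.triangle u v q
    have t6 := hd.comm p u
    have t7 := hdD u p
    have t8 := hdD v q
    have t9 : s * 200 ≤ 2 * d u v := by rw [← hsT]; gcongr
    have hs' : T * s ≤ T * min (R p) (R q) := by gcongr; exact le_min hp hq
    have t10 := hc p q hpq (by linarith)
    have t11 : (1 + 3 / T) * d p q ≤ (1 + 3 / T) * (d u v + 10 * s) := by gcongr; linarith
    have t12 : 3 / T * (10 * s) ≤ 1 / 10 * (10 * s) := by gcongr
    linarith

theorem linkGraph_adj {hd : IsPseudoDist d} {a b : V} (hR : ∀ v, 0 ≤ R v) (hT : 1 ≤ T)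
    (hrep : ∀ a b, Linked d R T a b → IsRep d R T a b (rep a b)) (h : Linked d R T a b) :
    (linkGraph hd R T rep).graph.Adj (rep a b) b :=
  ⟨(hrep a b h).ne hR hT h, a, b, h, Or.inl ⟨rfl, rfl⟩⟩

/-- Induction on the number of vertices of radius below `R b`. The representative `x` of a rerouted
link is itself linked to `a` and has smaller radius. Going from `a` to `x` and then along the edge
to `b` costs at most `3 * d a x` extra, and `T * d a x ≤ R b ≤ d a b` by separation. -/
theorem exists_walk_of_linked [Fintype V] (hd : IsPseudoDist d) (hR : IsNetRadius d R B)
    (hT : 3 ≤ T) (hrep : ∀ a b, Linked d R T a b → IsRep d R T a b (rep a b)) (k : ℕ) :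
    ∀ a b, Linked d R T a b → (Finset.univ.filter fun w => R w < R b).card = k →
    ∃ w : (linkGraph hd R T rep).graph.Walk a b,
      (linkGraph hd R T rep).walkLength w ≤ (1 + 3 / T) * d a b := by
  have hT0 : 0 < T := by linarith
  have h3 : 3 / T ≤ 1 := by rw [div_le_iff₀ hT0]; linarith
  have h3' : 0 ≤ 3 / T := by positivity
  induction k using Nat.strong_induction_on with
  | _ k ih =>
    intro a b hab hk
    have hadj := linkGraph_adj (hd := hd) hR.nonneg (by linarith) hrep hab
    have hx := hrep a b hab
    set x := rep a b with hxdef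
    have hlen : (linkGraph hd R T rep).len x b = d x b := rfl
    by_cases hxa : x = a
    · refine ⟨(SimpleGraph.Walk.cons hadj SimpleGraph.Walk.nil).copy hxa rfl, ?_⟩
      have : ∀ {y : V} (h : x = y) (p : (linkGraph hd R T rep).graph.Walk x b),
          (linkGraph hd R T rep).walkLength (p.copy h rfl) =
            (linkGraph hd R T rep).walkLength p := by
        rintro _ rfl p; rfl
      rw [this hxa, LengthGraph.walkLength_cons, LengthGraph.walkLength_nil, hlen, hxa]
      nlinarith [hd.nonneg a b]
    · have hsub : Substitute d R T a b x := by
        rcases hx with ⟨h, -⟩ | ⟨h, -⟩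
        · exact absurd h hxa
        · exact h
      have hxb : R x < R b := by
        have := mul_nonneg (sub_nonneg.2 (one_le_pow₀ (by linarith) : 1 ≤ T ^ 2)) (hR.nonneg x)
        linarith [hsub.2.2]
      obtain ⟨w, hw⟩ := ih _ (by
        rw [← hk]
        apply Finset.card_lt_card
        refine ⟨fun w hw => ?_, fun hsub => ?_⟩
        · simp only [Finset.mem_filter, Finset.mem_univ, true_and] at hw ⊢
          exact hw.trans hxb
        · have := @hsub x (by simpa using hxb)
          simp at this) a x ⟨Ne.symm hxa, (hxb.le.trans hab.2.1), hsub.2.1⟩ rfl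
      refine ⟨w.append (SimpleGraph.Walk.cons hadj SimpleGraph.Walk.nil), ?_⟩
      rw [LengthGraph.walkLength_append, LengthGraph.walkLength_cons, LengthGraph.walkLength_nil,
        hlen]
      have h1 := hx.mul_dist_le hd hR.nonneg (by linarith)
      have h2 := hR.sep a b hab.1
      rw [min_eq_right hab.2.1] at h2
      have h4 := hd.triangle x a b
      have h5 := hd.comm x a
      have h6 : d a x * 3 ≤ 3 / T * d a b := by
        rw [div_mul_eq_mul_div, le_div_iff₀ hT0]
        linarith
      have h7 : 3 / T * d a x ≤ 1 * d a x := by gcongr; exact hd.nonneg a x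
      linarith

variable [Fintype V] (hd : IsPseudoDist d) (hR : IsNetRadius d R B) (hB : ∀ u v, d u v ≤ B)
  (hT : 200 ≤ T) (hrep : ∀ a b, Linked d R T a b → IsRep d R T a b (rep a b))

include hR hB hT hrep

/-- The distance of a disconnected graph carries no information, so connectedness must precede the
stretch bound. It follows from `stretch_of_linked` for the pseudometric that is `d` inside
components and `2 * B + 1` across them: the latter exceeds every `(1 + 100 / T) * d u v`. -/
theorem linkGraph_connected [Nonempty V] : (linkGraph hd R T rep).graph.Connected := by
  classical
  set H := linkGraph hd R T rep
  refine ⟨fun u v => ?_⟩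
  by_contra huv
  set D : V → V → ℝ := fun u v => if H.graph.Reachable u v then d u v else 2 * B + 1 with hD
  have hB0 : 0 ≤ B := (hd.nonneg u u).trans (hB u u)
  have hdD : ∀ u v, d u v ≤ D u v := by
    intro u v
    simp only [hD]
    split_ifs
    · exact le_rfl
    · linarith [hB u v]
  have hDp : IsPseudoDist D := by
    refine ⟨fun u => ?_, fun u v => ?_, fun u v w => ?_⟩
    · simp only [hD, if_pos (SimpleGraph.Reachable.refl u), hd.self]
    · simp only [hD, hd.comm u v, SimpleGraph.reachable_comm (u := u)]
    · by_cases h1 : H.graph.Reachable u w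
      · have : D u w = d u w := if_pos h1
        linarith [hdD u v, hdD v w, hd.triangle u v w]
      · have h2 : D u w = 2 * B + 1 := if_neg h1
        by_cases h3 : H.graph.Reachable u v
        · have h4 : D v w = 2 * B + 1 := if_neg fun h => h1 (h3.trans h)
          linarith [hdD u v, hd.nonneg u v]
        · have h4 : D u v = 2 * B + 1 := if_neg h3
          linarith [hdD v w, hd.nonneg v w]
  have := stretch_of_linked hd hDp hdD hR hB hT (fun a b hab => by
    obtain ⟨w, -⟩ := exists_walk_of_linked hd hR (by linarith) hrep _ a b hab rfl
    have h3' : 0 ≤ 3 / T := by positivity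
    have : D a b = d a b := if_pos ⟨w⟩
    nlinarith [hd.nonneg a b]) u v
  have h1 : D u v = 2 * B + 1 := if_neg huv
  have h2 : 100 / T ≤ 1 / 2 := by rw [div_le_iff₀ (by linarith)]; linarith
  nlinarith [hB u v, hd.nonneg u v]

theorem le_dist_linkGraph (u v : V) : d u v ≤ (linkGraph hd R T rep).dist u v :=
  have : Nonempty V := ⟨u⟩
  LengthGraph.le_dist_of_triangle (linkGraph_connected hd hR hB hT hrep) hd.self hd.triangle
    (fun _ _ _ => le_rfl) u v

theorem dist_linkGraph_le (u v : V) :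
    (linkGraph hd R T rep).dist u v ≤ (1 + 100 / T) * d u v := by
  have : Nonempty V := ⟨u⟩
  refine stretch_of_linked hd
    (LengthGraph.isPseudoDist_dist (linkGraph_connected hd hR hB hT hrep))
    (le_dist_linkGraph hd hR hB hT hrep) hR hB hT (fun a b hab => ?_) u v
  obtain ⟨w, hw⟩ := exists_walk_of_linked hd hR (by linarith) hrep _ a b hab rfl
  exact (LengthGraph.dist_le_walkLength _ w).trans hw

end Stretch

/-! ### Packing bounds in doubling spaces -/

section Packing

variable {X : Type*} {d : X → X → ℝ} {N : ℕ}

theorem HasDoublingConstant.iterate (h : HasDoublingConstant d N) (m : ℕ) :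
    ∀ (x : X) (r : ℝ), 0 ≤ r → ∃ S : Finset X, S.card ≤ N ^ m ∧
      ∀ z, d x z < 2 ^ m * r → ∃ y ∈ S, d y z < r := by
  classical
  induction m with
  | zero => exact fun x r _ => ⟨{x}, by simp, fun z hz => ⟨x, by simp, by simpa using hz⟩⟩
  | succ m ih =>
    intro x r hr
    obtain ⟨S, hS, hcov⟩ := h x (2 ^ m * r) (by positivity)
    choose f hf hf' using fun y => ih y r hr
    refine ⟨S.biUnion f, ?_, fun z hz => ?_⟩
    · calc (S.biUnion f).card ≤ S.card * N ^ m := Finset.card_biUnion_le_card_mul _ _ _ fun y _ => hf y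
        _ ≤ N * N ^ m := by gcongr
        _ = N ^ (m + 1) := by ring
    · obtain ⟨y, hy, hyz⟩ := hcov z (by rw [pow_succ] at hz; linarith)
      obtain ⟨y', hy', h'⟩ := hf' y z hyz
      exact ⟨y', Finset.mem_biUnion.2 ⟨y, hy, hy'⟩, h'⟩

/-- A ball of radius `s / 2` contains at most one point of an `s`-separated set. -/
theorem HasDoublingConstant.card_le (h : HasDoublingConstant d N) (hd : IsPseudoDist d)
    {A : Finset X} {s : ℝ} {c : X} (m : ℕ) (hs : 0 < s)
    (hsep : ∀ a ∈ A, ∀ b ∈ A, a ≠ b → s ≤ d a b) (hA : ∀ a ∈ A, d c a < 2 ^ m * (s / 2)) :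
    A.card ≤ N ^ m := by
  obtain ⟨S, hS, hcov⟩ := h.iterate m c (s / 2) (by positivity)
  choose! f hf hf' using fun a ha => hcov a (hA a ha)
  refine le_trans (Finset.card_le_card_of_injOn f hf ?_) hS
  intro a ha b hb hab
  by_contra hne
  have h1 := hf' a ha
  have h2 := hf' b hb
  rw [← hab] at h2
  have h3 := hsep a ha b hb hne
  have h4 := hd.triangle a (f a) b
  have h5 := hd.comm a (f a)
  linarith

end Packing

/-! ### Few long edges of the link graph start in a ball -/

section Locality

variable {V : Type*} {d : V → V → ℝ} {R : V → ℝ} {B T r : ℝ} {rep : V → V → V}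
  {N m : ℕ}

/-- Two packings: the second vertices `b` are `s`-separated, and for fixed `b` the vertices to which
it is linked are `R b`-separated within distance `T * R b`. -/
theorem card_linked_le (h : HasDoublingConstant d N) (hd : IsPseudoDist d)
    (hR : IsNetRadius d R B) (hm : T ≤ 2 ^ m) {P : Finset (V × V)} {s : ℝ} {c : V} {k : ℕ}
    (hs : 0 < s) (hP : ∀ p ∈ P, Linked d R T p.1 p.2 ∧ s ≤ R p.2 ∧ d c p.2 < 2 ^ k * (s / 2)) :
    P.card ≤ N ^ (m + 2) * N ^ k := by
  classical
  calc P.card ≤ N ^ (m + 2) * (P.image Prod.snd).card := by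
        apply Finset.card_le_mul_card_image
        intro b hb
        obtain ⟨p, hp, rfl⟩ := Finset.mem_image.1 hb
        have hRb : 0 < R p.2 := hs.trans_le (hP p hp).2.1
        rw [← Finset.card_image_of_injOn (f := Prod.fst)]
        · refine h.card_le hd (s := R p.2) (c := p.2) _ hRb ?_ ?_
          · simp only [Finset.mem_image, Finset.mem_filter]
            rintro _ ⟨x, ⟨hx, hx2⟩, rfl⟩ _ ⟨y, ⟨hy, hy2⟩, rfl⟩ hne
            refine le_trans (le_min ?_ ?_) (hR.sep _ _ hne)
            · rw [← hx2]; exact (hP x hx).1.2.1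
            · rw [← hy2]; exact (hP y hy).1.2.1
          · simp only [Finset.mem_image, Finset.mem_filter]
            rintro _ ⟨x, ⟨hx, hx2⟩, rfl⟩
            have h1 := (hP x hx).1.2.2
            rw [hx2, hd.comm] at h1
            have h2 : T * R p.2 ≤ 2 ^ m * R p.2 := by gcongr
            have h3 : 0 < (2 : ℝ) ^ m * R p.2 := by positivity
            calc d p.2 x.1 < 2 * (2 ^ m * R p.2) := by linarith
              _ = 2 ^ (m + 2) * (R p.2 / 2) := by ring
        · intro x hx y hy hxy
          simp only [Finset.coe_filter, Set.mem_ofPred_eq] at hx hy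
          exact Prod.ext hxy (hx.2.trans hy.2.symm)
    _ ≤ N ^ (m + 2) * N ^ k := by
        gcongr
        refine h.card_le hd (s := s) (c := c) _ hs ?_ ?_
        · simp only [Finset.mem_image]
          rintro _ ⟨x, hx, rfl⟩ _ ⟨y, hy, rfl⟩ hne
          exact le_trans (le_min (hP x hx).2.1 (hP y hy).2.1) (hR.sep _ _ hne)
        · simp only [Finset.mem_image]
          rintro _ ⟨x, hx, rfl⟩
          exact (hP x hx).2.2

/-- With `s` the least radius of a second vertex, these vertices are `s`-separated and within `T ^ 3
* s` of the common first vertex. -/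
theorem card_linked_le_of_fst_eq (h : HasDoublingConstant d N) (hd : IsPseudoDist d)
    (hR : IsNetRadius d R B) (hT : 0 < T) (hm : T ≤ 2 ^ m) {P : Finset (V × V)}
    (hP : ∀ p ∈ P, Linked d R T p.1 p.2 ∧ 0 < R p.2)
    (hfst : ∀ p ∈ P, ∀ q ∈ P, p.1 = q.1)
    (hsc : ∀ p ∈ P, ∀ q ∈ P, R p.2 ≤ T ^ 2 * R q.2) :
    P.card ≤ N ^ (3 * m + 2) := by
  classical
  rcases P.eq_empty_or_nonempty with rfl | hne
  · simp
  obtain ⟨p, hp, hmin⟩ := Finset.exists_min_image P (fun p => R p.2) hne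
  have hRb := (hP p hp).2
  rw [← Finset.card_image_of_injOn (f := Prod.snd)]
  · refine h.card_le hd (s := R p.2) (c := p.1) _ hRb ?_ ?_
    · simp only [Finset.mem_image]
      rintro _ ⟨x, hx, rfl⟩ _ ⟨y, hy, rfl⟩ hne
      exact le_trans (le_min (hmin x hx) (hmin y hy)) (hR.sep _ _ hne)
    · simp only [Finset.mem_image]
      rintro _ ⟨x, hx, rfl⟩
      rw [hfst p hp x hx]
      calc d x.1 x.2 ≤ T * R x.2 := (hP x hx).1.2.2
        _ ≤ T * (T ^ 2 * R p.2) := by gcongr; exact hsc x hx p hp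
        _ = T ^ 3 * R p.2 := by ring
        _ ≤ (2 ^ m) ^ 3 * R p.2 := by gcongr
        _ < 2 * ((2 ^ m) ^ 3 * R p.2) := by
          have : 0 < ((2 : ℝ) ^ m) ^ 3 * R p.2 := by positivity
          linarith
        _ = 2 ^ (3 * m + 2) * (R p.2 / 2) := by ring
  · intro x hx y hy hxy
    exact Prod.ext (hfst x hx y hy) hxy

/-- Edges are counted through the links `(a, b)` that produce them. If `b` is in the ball or has
radius at most `T ^ 2 * r`, packing suffices. Otherwise the representative is in the ball and `R b`
is large; in each of three cases `a` is unique, and the choice of representatives confines the radii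
of the `b` to a factor `T ^ 2`. -/
theorem card_linkGraph_long_edges_le [Fintype V] [DecidableEq V] (h : HasDoublingConstant d N)
    (hN : 1 ≤ N) (hd : IsPseudoDist d)
    (hR : IsNetRadius d R B) (hT : 200 ≤ T) (hm : T ≤ 2 ^ m)
    (hrep : ∀ a b, Linked d R T a b → IsRep d R T a b (rep a b)) (hr : 0 < r) (c : V)
    {F : Finset (V × V)} (hF : ∀ p ∈ F, (linkGraph hd R T rep).graph.Adj p.1 p.2 ∧
      r ≤ d p.1 p.2 ∧ d c p.1 < 2 * r) :
    F.card ≤ 5 * N ^ (5 * m + 6) := by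
  classical
  have hT0 : 0 < T := by linarith
  set L : Finset (V × V) := Finset.univ.filter fun p =>
    Linked d R T p.1 p.2 ∧ r ≤ d (rep p.1 p.2) p.2 with hL
  have hLl : ∀ p ∈ L, Linked d R T p.1 p.2 := fun p hp => (Finset.mem_filter.1 hp).2.1
  have hrepa : ∀ p ∈ L, T * d p.1 (rep p.1 p.2) ≤ R p.2 := fun p hp =>
    (hrep _ _ (hLl p hp)).mul_dist_le hd hR.nonneg (by linarith)
  have hlen : ∀ p ∈ L, d (rep p.1 p.2) p.2 ≤ 2 * T * R p.2 := by
    intro p hp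
    have h1 := hrepa p hp
    have h2 := hd.triangle (rep p.1 p.2) p.1 p.2
    have h3 := hd.comm (rep p.1 p.2) p.1
    have h4 := (hLl p hp).2.2
    have h5 := hd.nonneg p.1 (rep p.1 p.2)
    have h6 : 200 * d p.1 (rep p.1 p.2) ≤ T * d p.1 (rep p.1 p.2) := by gcongr
    have h7 : 200 * R p.2 ≤ T * R p.2 := by gcongr; exact hR.nonneg _
    linarith [hR.nonneg p.2]
  -- Long edges come only from large radii, since an edge is hardly longer than its link.
  have hLs : ∀ p ∈ L, r / (2 * T) ≤ R p.2 := by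
    intro p hp
    rw [div_le_iff₀' (by positivity)]
    exact (Finset.mem_filter.1 hp).2.2.trans (hlen p hp)
  have hLpos : ∀ p ∈ L, 0 < R p.2 := fun p hp =>
    lt_of_lt_of_le (by positivity) (hLs p hp)
  set Q := L.filter fun p => d c (rep p.1 p.2) < 2 * r with hQ
  have hQL : ∀ p ∈ Q, p ∈ L := fun p hp => (Finset.mem_filter.1 hp).1
  have hQc : ∀ p ∈ Q, d c (rep p.1 p.2) < 2 * r := fun p hp => (Finset.mem_filter.1 hp).2
  set Q1 := L.filter fun p => d c p.2 < 2 * r with hQ1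
  set Q2 := Q.filter fun p => R p.2 ≤ T ^ 2 * r with hQ2
  set Q3 := Q.filter fun p => T ^ 2 * r < R p.2 ∧ rep p.1 p.2 = p.1 with hQ3
  set Q4 := Q.filter fun p => T ^ 2 * r < R p.2 ∧ rep p.1 p.2 ≠ p.1 ∧ 4 * r ≤ R (rep p.1 p.2)
    with hQ4
  set Q5 := Q.filter fun p => T ^ 2 * r < R p.2 ∧ rep p.1 p.2 ≠ p.1 ∧ R (rep p.1 p.2) < 4 * r
    with hQ5
  have hsubst : ∀ p ∈ L, rep p.1 p.2 ≠ p.1 → Substitute d R T p.1 p.2 (rep p.1 p.2) ∧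
      ∀ q, Substitute d R T p.1 p.2 q → R q ≤ R (rep p.1 p.2) := by
    intro p hp hne
    rcases hrep _ _ (hLl p hp) with ⟨h1, -⟩ | h1
    · exact absurd h1 hne
    · exact h1
  have hsub' : ∀ p ∈ L, ∀ q ∈ L, p.1 = q.1 → T ^ 2 * R p.2 < R q.2 →
      Substitute d R T q.1 q.2 p.2 := by
    intro p hp q hq hpq hlt
    have h1 := hLl p hp
    rw [hpq] at h1
    exact ⟨h1.1.symm, h1.2.2, hlt⟩
  have hTT : 40000 ≤ T ^ 2 := by nlinarith
  have c1 : Q1.card ≤ N ^ (m + 2) * N ^ (m + 3) := by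
    refine card_linked_le h hd hR hm (s := r / (2 * T)) (c := c) (by positivity) ?_
    intro p hp
    have hpL := (Finset.mem_filter.1 hp).1
    refine ⟨hLl p hpL, hLs p hpL, (Finset.mem_filter.1 hp).2.trans_le ?_⟩
    have : 2 ^ (m + 3) * (r / (2 * T) / 2) = 2 * r * (2 ^ m / T) := by field_simp; ring
    rw [this]
    have : 1 ≤ 2 ^ m / T := by rwa [one_le_div hT0]
    nlinarith
  have c2 : Q2.card ≤ N ^ (m + 2) * N ^ (4 * m + 4) := by
    refine card_linked_le h hd hR hm (s := r / (2 * T)) (c := c) (by positivity) ?_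
    intro p hp
    have hpQ := (Finset.mem_filter.1 hp).1
    have hpL := hQL p hpQ
    refine ⟨hLl p hpL, hLs p hpL, ?_⟩
    have h1 := hQc p hpQ
    have h2 := hlen p hpL
    have h3 := hd.triangle c (rep p.1 p.2) p.2
    have h4 : 2 * T * R p.2 ≤ 2 * T * (T ^ 2 * r) := by
      gcongr; exact (Finset.mem_filter.1 hp).2
    have h5 : 2 ^ (4 * m + 4) * (r / (2 * T) / 2) = 4 * r * ((2 ^ m) ^ 4 / T) := by
      field_simp; ring
    rw [h5]
    have h6 : T ^ 4 / T ≤ (2 ^ m) ^ 4 / T := by gcongr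
    have h7 : T ^ 4 / T = T ^ 3 := by field_simp
    have h8 : 4 * r * T ^ 3 ≤ 4 * r * ((2 ^ m) ^ 4 / T) := by rw [← h7]; gcongr
    have h9 : 1 * r ≤ T ^ 3 * r := by gcongr; nlinarith
    nlinarith
  -- Here `a` itself is in the ball and its radius exceeds `T ^ 2 * r`, so separation makes it
  -- unique. A second vertex of much smaller radius would have been a candidate for replacing `a`.
  have c3 : Q3.card ≤ N ^ (3 * m + 2) := by
    have hQ3' : ∀ p ∈ Q3, p ∈ Q ∧ T ^ 2 * r < R p.2 ∧ rep p.1 p.2 = p.1 :=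
      fun p hp => Finset.mem_filter.1 hp
    have hfst : ∀ p ∈ Q3, ∀ q ∈ Q3, p.1 = q.1 := by
      intro p hp q hq
      obtain ⟨hp, hp1, hp2⟩ := hQ3' p hp
      obtain ⟨hq, hq1, hq2⟩ := hQ3' q hq
      by_contra hne
      have h1 := hQc p hp
      have h2 := hQc q hq
      rw [hp2] at h1
      rw [hq2] at h2
      have h3 := hR.sep _ _ hne
      have h4 := (hLl p (hQL p hp)).2.1
      have h5 := (hLl q (hQL q hq)).2.1
      have h6 : T ^ 2 * r ≤ min (R p.1) (R q.1) := le_min (by linarith) (by linarith)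
      have h7 := hd.triangle p.1 c q.1
      have h8 := hd.comm p.1 c
      nlinarith
    refine card_linked_le_of_fst_eq h hd hR hT0 hm
      (fun p hp => ⟨hLl p (hQL p (hQ3' p hp).1), hLpos p (hQL p (hQ3' p hp).1)⟩) hfst ?_
    intro p hp q hq
    by_contra! hlt
    have h1 := hsub' q (hQL q (hQ3' q hq).1) p (hQL p (hQ3' p hp).1) (hfst q hq p hp) hlt
    have h2 := (hQ3' p hp).2.2
    rcases hrep _ _ (hLl p (hQL p (hQ3' p hp).1)) with ⟨-, h3⟩ | ⟨h3, -⟩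
    · exact h3 _ h1
    · exact h3.1 h2
  -- The representative `x` is unique because two vertices of radius at least `4 * r` do not fit in
  -- the ball. Then `a` is unique: it is within `T * R x` of `x`, while `R a` exceeds `T ^ 2 * R x`.
  have c4 : Q4.card ≤ N ^ (3 * m + 2) := by
    have hQ4' : ∀ p ∈ Q4, p ∈ Q ∧ T ^ 2 * r < R p.2 ∧ rep p.1 p.2 ≠ p.1 ∧
      4 * r ≤ R (rep p.1 p.2) := fun p hp => Finset.mem_filter.1 hp
    have hrepeq : ∀ p ∈ Q4, ∀ q ∈ Q4, rep p.1 p.2 = rep q.1 q.2 := by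
      intro p hp q hq
      obtain ⟨hp, hp1, hp2, hp3⟩ := hQ4' p hp
      obtain ⟨hq, hq1, hq2, hq3⟩ := hQ4' q hq
      by_contra hne
      have h1 := hQc p hp
      have h2 := hQc q hq
      have h3 := hR.sep _ _ hne
      have h6 := le_min hp3 hq3
      have h7 := hd.triangle (rep p.1 p.2) c (rep q.1 q.2)
      have h8 := hd.comm (rep p.1 p.2) c
      linarith
    have hfst : ∀ p ∈ Q4, ∀ q ∈ Q4, p.1 = q.1 := by
      intro p hp' q hq'
      have hx := hrepeq p hp' q hq'
      obtain ⟨hp, hp1, hp2, hp3⟩ := hQ4' p hp'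
      obtain ⟨hq, hq1, hq2, hq3⟩ := hQ4' q hq'
      by_contra hne
      have h1 := (hsubst p (hQL p hp) hp2).1
      have h2 := (hsubst q (hQL q hq) hq2).1
      rw [← hx] at h2
      have h3 := hR.sep _ _ hne
      have h4 := (hLl p (hQL p hp)).2.1
      have h5 := (hLl q (hQL q hq)).2.1
      have h6 : T ^ 2 * R (rep p.1 p.2) ≤ min (R p.1) (R q.1) :=
        le_min (by linarith [h1.2.2]) (by linarith [h2.2.2])
      have h7 := hd.triangle p.1 (rep p.1 p.2) q.1
      have h8 := hd.comm (rep p.1 p.2) q.1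
      have h9 := h1.2.1
      have h10 := h2.2.1
      have h11 : 0 < T * R (rep p.1 p.2) := mul_pos hT0 (by linarith)
      have h12 : 200 * (T * R (rep p.1 p.2)) ≤ T * (T * R (rep p.1 p.2)) := by gcongr
      linarith
    refine card_linked_le_of_fst_eq h hd hR hT0 hm
      (fun p hp => ⟨hLl p (hQL p (hQ4' p hp).1), hLpos p (hQL p (hQ4' p hp).1)⟩) hfst ?_
    intro p hp q hq
    by_contra! hlt
    have h1 := hsub' q (hQL q (hQ4' q hq).1) p (hQL p (hQ4' p hp).1) (hfst q hq p hp) hlt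
    have h2 := (hsubst p (hQL p (hQ4' p hp).1) (hQ4' p hp).2.2.1).2 _ h1
    have h3 := (hsubst q (hQL q (hQ4' q hq).1) (hQ4' q hq).2.2.1).1.2.2
    rw [← hrepeq p hp q hq] at h3
    nlinarith [hR.nonneg (rep p.1 p.2)]
  -- Representatives may differ, but all are within `4 * T * r` of their `a`, whose radius exceeds
  -- `T ^ 2 * r`; so `a` is unique. A much lower second vertex would be a candidate of radius above
  -- `T ^ 2 * r`, whereas the best candidate has radius below `4 * r`.
  have c5 : Q5.card ≤ N ^ (3 * m + 2) := by
    have hQ5' : ∀ p ∈ Q5, p ∈ Q ∧ T ^ 2 * r < R p.2 ∧ rep p.1 p.2 ≠ p.1 ∧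
      R (rep p.1 p.2) < 4 * r := fun p hp => Finset.mem_filter.1 hp
    have hfst : ∀ p ∈ Q5, ∀ q ∈ Q5, p.1 = q.1 := by
      intro p hp q hq
      obtain ⟨hp, hp1, hp2, hp3⟩ := hQ5' p hp
      obtain ⟨hq, hq1, hq2, hq3⟩ := hQ5' q hq
      by_contra hne
      have h1 := (hsubst p (hQL p hp) hp2).1.2.1
      have h2 := (hsubst q (hQL q hq) hq2).1.2.1
      have h3 := hR.sep _ _ hne
      have h4 := (hLl p (hQL p hp)).2.1
      have h5 := (hLl q (hQL q hq)).2.1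
      have h6 : T ^ 2 * r ≤ min (R p.1) (R q.1) := le_min (by linarith) (by linarith)
      have h7 := hd.triangle p.1 (rep p.1 p.2) q.1
      have h8 := hd.triangle (rep p.1 p.2) c q.1
      have h9 := hd.triangle c (rep q.1 q.2) q.1
      have h10 := hd.comm (rep p.1 p.2) c
      have h11 := hd.comm (rep q.1 q.2) q.1
      have h12 := hQc p hp
      have h13 := hQc q hq
      have h14 : T * R (rep p.1 p.2) ≤ T * (4 * r) := by gcongr
      have h15 : T * R (rep q.1 q.2) ≤ T * (4 * r) := by gcongr
      have h16 : 200 * (T * r) ≤ T * (T * r) := by gcongr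
      have h17 : 200 * r ≤ T * r := by gcongr
      linarith
    refine card_linked_le_of_fst_eq h hd hR hT0 hm
      (fun p hp => ⟨hLl p (hQL p (hQ5' p hp).1), hLpos p (hQL p (hQ5' p hp).1)⟩) hfst ?_
    intro p hp q hq
    by_contra! hlt
    have h1 := hsub' q (hQL q (hQ5' q hq).1) p (hQL p (hQ5' p hp).1) (hfst q hq p hp) hlt
    have h2 := (hsubst p (hQL p (hQ5' p hp).1) (hQ5' p hp).2.2.1).2 _ h1
    have h3 := (hQ5' p hp).2.2.2
    have h4 := (hQ5' q hq).2.1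
    nlinarith
  -- The first entry of an oriented edge, the one in the ball, is either the `b` of a link (`Q1`) or
  -- its representative (the other four classes).
  have hcover : F ⊆ Q1.image (fun p => (p.2, rep p.1 p.2)) ∪
      (Q2 ∪ (Q3 ∪ (Q4 ∪ Q5))).image (fun p => (rep p.1 p.2, p.2)) := by
    rintro ⟨w, w'⟩ hw
    obtain ⟨⟨-, a, b, hab, h1⟩, h2, h3⟩ := hF _ hw
    simp only at h1 h2 h3
    rw [Finset.mem_union, Finset.mem_image, Finset.mem_image]
    rcases h1 with ⟨rfl, rfl⟩ | ⟨rfl, rfl⟩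
    · refine Or.inr ⟨(a, w'), ?_, rfl⟩
      have hmem : (a, w') ∈ Q := by simp [hQ, hL, hab, h2, h3]
      simp only [hQ2, hQ3, hQ4, hQ5, Finset.mem_union, Finset.mem_filter, hmem, true_and]
      by_cases h4 : R w' ≤ T ^ 2 * r
      · exact Or.inl h4
      · have h4' := not_le.1 h4
        by_cases h5 : rep a w' = a
        · exact Or.inr (Or.inl ⟨h4', h5⟩)
        · rcases le_or_gt (4 * r) (R (rep a w')) with h6 | h6
          · exact Or.inr (Or.inr (Or.inl ⟨h4', h5, h6⟩))
          · exact Or.inr (Or.inr (Or.inr ⟨h4', h5, h6⟩))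
    · refine Or.inl ⟨(a, w), ?_, rfl⟩
      rw [hd.comm] at h2
      simp [hQ1, hL, hab, h2, h3]
  have e1 : N ^ (m + 2) * N ^ (m + 3) ≤ N ^ (5 * m + 6) := by
    rw [← pow_add]; exact Nat.pow_le_pow_right hN (by omega)
  have e2 : N ^ (m + 2) * N ^ (4 * m + 4) ≤ N ^ (5 * m + 6) := by
    rw [← pow_add]; exact Nat.pow_le_pow_right hN (by omega)
  have e3 : N ^ (3 * m + 2) ≤ N ^ (5 * m + 6) := Nat.pow_le_pow_right hN (by omega)
  have u1 := Finset.card_le_card hcover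
  have u2 := Finset.card_union_le (Q1.image (fun p => (p.2, rep p.1 p.2)))
    ((Q2 ∪ (Q3 ∪ (Q4 ∪ Q5))).image (fun p => (rep p.1 p.2, p.2)))
  have u3 := Finset.card_image_le (s := Q1) (f := fun p => (p.2, rep p.1 p.2))
  have u4 := Finset.card_image_le (s := Q2 ∪ (Q3 ∪ (Q4 ∪ Q5))) (f := fun p => (rep p.1 p.2, p.2))
  have u5 := Finset.card_union_le Q2 (Q3 ∪ (Q4 ∪ Q5))
  have u6 := Finset.card_union_le Q3 (Q4 ∪ Q5)
  have u7 := Finset.card_union_le Q4 Q5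
  omega

end Locality

/-! ### Doubling constant of the convex closure -/

namespace LengthGraph

section Conv

variable {V : Type*} [LinearOrder V] {G : LengthGraph V}

open Classical in
/-- The point at distance `t` from `w` on the edge `{w, w'}`; the vertex `w` if there is no such
interior point. -/
noncomputable def pointAt (G : LengthGraph V) (w w' : V) (t : ℝ) : ConvPoint G :=
  if h : w < w' ∧ G.graph.Adj w w' ∧ 0 < t ∧ t < G.len w w' then
    .edge ⟨w, w', h.1, h.2.1, t, h.2.2.1, h.2.2.2⟩
  else if h : w' < w ∧ G.graph.Adj w' w ∧ 0 < t ∧ t < G.len w' w then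
    .edge ⟨w', w, h.1, h.2.1, G.len w' w - t, by linarith [h.2.2.2], by linarith [h.2.2.1]⟩
  else .vertex w

/-- The point `q` lies on the edge `{w, w'}` at distance `t` from `w`. -/
def EdgePoint.At (q : EdgePoint G) (w w' : V) (t : ℝ) : Prop :=
  (w = q.u ∧ w' = q.v ∧ t = q.x) ∨ (w = q.v ∧ w' = q.u ∧ t = G.len q.u q.v - q.x)

namespace EdgePoint.At

variable {q : EdgePoint G} {w w' : V} {t : ℝ}

theorem adj (h : q.At w w' t) : G.graph.Adj w w' := by
  rcases h with ⟨rfl, rfl, -⟩ | ⟨rfl, rfl, -⟩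
  exacts [q.adj, q.adj.symm]

theorem pos (h : q.At w w' t) : 0 < t := by
  rcases h with ⟨-, -, rfl⟩ | ⟨-, -, rfl⟩
  exacts [q.x_pos, sub_pos.2 q.x_lt]

theorem lt_len (h : q.At w w' t) : t < G.len w w' := by
  rcases h with ⟨rfl, rfl, rfl⟩ | ⟨rfl, rfl, rfl⟩
  · exact q.x_lt
  · rw [G.len_symm _ _ q.adj]
    linarith [q.x_pos]

theorem convDist_vertex_le (h : q.At w w' t) (y : V) :
    G.convDist (.vertex y) (.edge q) ≤ t + G.dist w y := by
  rcases h with ⟨rfl, rfl, rfl⟩ | ⟨rfl, rfl, rfl⟩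
  exacts [min_le_left _ _, min_le_right _ _]

theorem convDist_vertex_le' (h : q.At w w' t) (y : V) :
    G.convDist (.vertex y) (.edge q) ≤ G.len w w' - t + G.dist w' y := by
  rcases h with ⟨rfl, rfl, rfl⟩ | ⟨rfl, rfl, rfl⟩
  · exact min_le_right _ _
  · refine (min_le_left _ _).trans ?_
    rw [G.len_symm _ _ q.adj]
    linarith

theorem convDist_pointAt_le (h : q.At w w' t) {s : ℝ} (h0 : 0 < s) (hs : s < G.len w w') :
    G.convDist (G.pointAt w w' s) (.edge q) ≤ |s - t| := by
  rcases h with ⟨rfl, rfl, rfl⟩ | ⟨rfl, rfl, rfl⟩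
  · rw [pointAt, dif_pos ⟨q.lt, q.adj, h0, hs⟩]
    simp only [convDist, and_self, if_true]
    exact min_le_left _ _
  · rw [G.len_symm _ _ q.adj.symm] at hs
    rw [pointAt, dif_neg fun h => lt_asymm h.1 q.lt, dif_pos ⟨q.lt, q.adj, h0, hs⟩]
    simp only [convDist, and_self, if_true]
    refine (min_le_left _ _).trans ?_
    rw [abs_sub_comm]
    apply le_of_eq
    congr 1
    ring

end EdgePoint.At

/-- The ways in which a point can be at distance less than `ρ` from `x`: through one of two
vertices near `x`, or along the edge of `x`. -/
theorem exists_anchors (hG : G.graph.Connected) (x : ConvPoint G) :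
    ∃ x₁ x₂ : V, ∃ S : ℝ → Finset (ConvPoint G), (∀ r, (S r).card ≤ 3) ∧
      ∀ r, 0 < r → ∀ z, G.convDist x z < 2 * r → (∃ y ∈ S r, G.convDist y z < r) ∨
        ∃ a, (a = x₁ ∨ a = x₂) ∧
          ((∃ w, z = .vertex w ∧ G.dist a w < 2 * r) ∨
            ∃ q w w' t, z = .edge q ∧ q.At w w' t ∧ G.dist a w + t < 2 * r) := by
  classical
  cases x with
  | vertex x =>
    refine ⟨x, x, fun _ => ∅, fun _ => by simp, fun r hr z hz => Or.inr ⟨x, Or.inl rfl, ?_⟩⟩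
    cases z with
    | vertex w => exact Or.inl ⟨w, rfl, hz⟩
    | edge q =>
      right
      rcases min_lt_iff.1 hz with h | h
      · exact ⟨q, q.u, q.v, _, rfl, Or.inl ⟨rfl, rfl, rfl⟩, by rw [dist_comm hG]; linarith⟩
      · exact ⟨q, q.v, q.u, _, rfl, Or.inr ⟨rfl, rfl, rfl⟩, by rw [dist_comm hG]; linarith⟩
  | edge p =>
    -- The three points cover what is reached along the edge of `x`. A shifted point is used only if
    -- it lies between `x` and the point to be covered, hence is interior; otherwise the default
    -- value of `pointAt` is harmless.
    refine ⟨p.u, p.v, fun r => ({p.x, p.x + r, p.x - r} : Finset ℝ).image (G.pointAt p.u p.v),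
      fun r => Finset.card_image_le.trans Finset.card_le_three, fun r hr z hz => ?_⟩
    have hx0 := p.x_pos
    have hx1 := p.x_lt
    cases z with
    | vertex w =>
      right
      rcases min_lt_iff.1 hz with h | h
      · exact ⟨p.u, Or.inl rfl, Or.inl ⟨w, rfl, by linarith⟩⟩
      · exact ⟨p.v, Or.inr rfl, Or.inl ⟨w, rfl, by linarith⟩⟩
    | edge q =>
      have key : G.edgeEdgeDist p q < 2 * r → ∃ a, (a = p.u ∨ a = p.v) ∧
          ((∃ w, ConvPoint.edge q = .vertex w ∧ G.dist a w < 2 * r) ∨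
            ∃ q' w w' t, ConvPoint.edge q = .edge q' ∧ q'.At w w' t ∧
              G.dist a w + t < 2 * r) := by
        intro h
        simp only [edgeEdgeDist, min_lt_iff] at h
        rcases h with (h | h) | (h | h)
        · exact ⟨p.u, Or.inl rfl, Or.inr ⟨q, q.u, q.v, _, rfl, Or.inl ⟨rfl, rfl, rfl⟩,
            by linarith⟩⟩
        · exact ⟨p.u, Or.inl rfl, Or.inr ⟨q, q.v, q.u, _, rfl, Or.inr ⟨rfl, rfl, rfl⟩,
            by linarith⟩⟩
        · exact ⟨p.v, Or.inr rfl, Or.inr ⟨q, q.u, q.v, _, rfl, Or.inl ⟨rfl, rfl, rfl⟩,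
            by linarith⟩⟩
        · exact ⟨p.v, Or.inr rfl, Or.inr ⟨q, q.v, q.u, _, rfl, Or.inr ⟨rfl, rfl, rfl⟩,
            by linarith⟩⟩
      by_cases hpq : p.u = q.u ∧ p.v = q.v
      · simp only [convDist, if_pos hpq, min_lt_iff] at hz
        rcases hz with hz | hz
        · left
          have hq : q.At p.u p.v q.x := Or.inl ⟨hpq.1, hpq.2, rfl⟩
          have hq0 := hq.pos
          have hq1 := hq.lt_len
          rw [abs_lt] at hz
          have : ∃ s, (s = p.x ∨ s = p.x + r ∨ s = p.x - r) ∧ 0 < s ∧ s < G.len p.u p.v ∧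
              |s - q.x| < r := by
            rcases le_or_gt (p.x + r) q.x with h1 | h1
            · exact ⟨p.x + r, by simp, by linarith, by linarith,
                by rw [abs_lt]; constructor <;> linarith⟩
            · rcases le_or_gt q.x (p.x - r) with h2 | h2
              · exact ⟨p.x - r, by simp, by linarith, by linarith,
                  by rw [abs_lt]; constructor <;> linarith⟩
              · exact ⟨p.x, by simp, by linarith, by linarith,
                  by rw [abs_lt]; constructor <;> linarith⟩
          obtain ⟨s, hs, h0, h1, h2⟩ := this
          exact ⟨_, Finset.mem_image_of_mem _ (by simpa using hs),
            (hq.convDist_pointAt_le h0 h1).trans_lt h2⟩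
        · exact Or.inr (key hz)
      · simp only [convDist, if_neg hpq] at hz
        exact Or.inr (key hz)

/-- The convex closure of a graph is doubling if its metric is comparable to a doubling metric and
few long edges meet a ball. -/
theorem hasDoublingConstant_convDist [Fintype V] (hG : G.graph.Connected) {d : V → V → ℝ}
    (h1 : ∀ u v, d u v ≤ G.dist u v) (h2 : ∀ u v, G.dist u v ≤ 3 / 2 * d u v) {N Λ : ℕ}
    (hN : HasDoublingConstant d N)
    (hΛ : ∀ (r : ℝ) (c : V) (F : Finset (V × V)), 0 < r → (∀ p ∈ F, G.graph.Adj p.1 p.2 ∧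
      r ≤ G.len p.1 p.2 ∧ d c p.1 < 2 * r) → F.card ≤ Λ) :
    HasDoublingConstant G.convDist (2 * N ^ 4 + 6 * Λ + 3) := by
  classical
  have hconv_nonneg : ∀ x z : ConvPoint G, 0 ≤ G.convDist x z := by
    have hnn := G.dist_nonneg
    intro x z
    rcases x with w | p <;> rcases z with w' | q
    · exact hnn _ _
    · have := q.x_pos; have := q.x_lt
      exact le_min (by linarith [hnn q.u w]) (by linarith [hnn q.v w])
    · have := p.x_pos; have := p.x_lt
      exact le_min (by linarith [hnn p.u w']) (by linarith [hnn p.v w'])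
    · have := q.x_pos; have := q.x_lt; have := p.x_pos; have := p.x_lt
      have h : 0 ≤ G.edgeEdgeDist p q :=
        le_min (le_min (by linarith [hnn p.u q.u]) (by linarith [hnn p.u q.v]))
          (le_min (by linarith [hnn p.v q.u]) (by linarith [hnn p.v q.v]))
      simp only [convDist]
      split_ifs
      exacts [le_min (abs_nonneg _) h, h]
  intro x r hr
  rcases hr.eq_or_lt with rfl | hr
  · exact ⟨∅, by simp, fun z hz => absurd hz (by simpa using hconv_nonneg x z)⟩
  obtain ⟨x₁, x₂, S, hS, hcov⟩ := exists_anchors hG x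
  -- Radius `4 * r` also catches the far ends of edges shorter than `r`. Radius `r / 4` for `d`
  -- becomes less than `r / 2` for `G.dist`, which leaves `r / 2` to spend along an edge.
  choose W hWc hW using fun a : V => hN.iterate 4 a (r / 4) (by positivity)
  set F : V → Finset (V × V) := fun a => Finset.univ.filter fun p =>
    G.graph.Adj p.1 p.2 ∧ r ≤ G.len p.1 p.2 ∧ d a p.1 < 2 * r with hF
  have hFc : ∀ a, (F a).card ≤ Λ := fun a =>
    hΛ r a (F a) hr fun p hp => (Finset.mem_filter.1 hp).2
  -- Points within `r / 2` of an end of their edge are reached from the vertices in `W a`. On an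
  -- edge of length at least `r` the remaining positions lie between `r / 2` and `2 * r` from the
  -- near end, and the multiples 1, 2, 3 of `r / 2` serve them.
  set P : V → Finset (ConvPoint G) := fun a =>
    (W a).image ConvPoint.vertex ∪ ((F a) ×ˢ ({1, 2, 3} : Finset ℝ)).image
      (fun p => G.pointAt p.1.1 p.1.2 (p.2 * (r / 2))) with hP
  have hPc : ∀ a, (P a).card ≤ N ^ 4 + Λ * 3 := fun a => by
    refine (Finset.card_union_le _ _).trans (add_le_add ?_ ?_)
    · exact Finset.card_image_le.trans (hWc a)
    · refine Finset.card_image_le.trans ?_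
      rw [Finset.card_product]
      exact Nat.mul_le_mul (hFc a) Finset.card_le_three
  refine ⟨S r ∪ (P x₁ ∪ P x₂), ?_, fun z hz => ?_⟩
  · have := Finset.card_union_le (S r) (P x₁ ∪ P x₂)
    have := Finset.card_union_le (P x₁) (P x₂)
    have := hPc x₁
    have := hPc x₂
    have := hS r
    omega
  · rcases hcov r hr z hz with ⟨y, hy, hyz⟩ | ⟨a, ha, h⟩
    · exact ⟨y, Finset.mem_union_left _ hy, hyz⟩
    suffices ∃ y ∈ P a, G.convDist y z < r by
      obtain ⟨y, hy, hyz⟩ := this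
      refine ⟨y, ?_, hyz⟩
      rcases ha with rfl | rfl <;> simp [hy]
    have hWa : ∀ w, d a w < 4 * r → ∃ y ∈ W a, G.dist y w < r / 2 := by
      intro w hw
      obtain ⟨y, hy, hyw⟩ := hW a w (by linarith)
      exact ⟨y, hy, by linarith [h2 y w]⟩
    have hWP : ∀ y ∈ W a, ConvPoint.vertex y ∈ P a := fun y hy =>
      Finset.mem_union_left _ (Finset.mem_image_of_mem _ hy)
    rcases h with ⟨w, rfl, hw⟩ | ⟨q, w, w', t, rfl, hq, hw⟩
    · obtain ⟨y, hy, hyw⟩ := hWa w (by linarith [h1 a w])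
      exact ⟨_, hWP y hy, show G.dist y w < r by linarith⟩
    · have ht0 := hq.pos
      have ht1 := hq.lt_len
      have hda := G.dist_nonneg a w
      have hdw := h1 a w
      by_cases ht : t < r / 2
      · obtain ⟨y, hy, hyw⟩ := hWa w (by linarith)
        refine ⟨_, hWP y hy, (hq.convDist_vertex_le y).trans_lt ?_⟩
        rw [dist_comm hG]
        linarith
      push Not at ht
      by_cases hl : G.len w w' < r
      · obtain ⟨y, hy, hyw⟩ := hWa w' (by
          have e1 := h1 a w'
          have e2 := dist_triangle hG a w w'
          have e3 := G.dist_le_len hq.adj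
          linarith)
        refine ⟨_, hWP y hy, (hq.convDist_vertex_le' y).trans_lt ?_⟩
        rw [dist_comm hG]
        linarith
      push Not at hl
      have hwF : (w, w') ∈ F a := by
        simp only [hF, Finset.mem_filter, Finset.mem_univ, true_and]
        exact ⟨hq.adj, hl, by linarith⟩
      have : ∃ j : ℝ, (j = 1 ∨ j = 2 ∨ j = 3) ∧ j * (r / 2) ≤ t ∧ t < j * (r / 2) + r := by
        rcases le_or_gt (3 * (r / 2)) t with e | e
        · exact ⟨3, by simp, e, by linarith⟩
        rcases le_or_gt (2 * (r / 2)) t with e' | e'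
        · exact ⟨2, by simp, e', by linarith⟩
        exact ⟨1, by simp, by linarith, by linarith⟩
      obtain ⟨j, hj, hj1, hj2⟩ := this
      have hj0 : 0 < j * (r / 2) := by
        rcases hj with rfl | rfl | rfl <;> positivity
      refine ⟨G.pointAt w w' (j * (r / 2)), Finset.mem_union_right _
        (Finset.mem_image.2 ⟨((w, w'), j), Finset.mem_product.2 ⟨hwF, by simpa using hj⟩, rfl⟩),
        (hq.convDist_pointAt_le hj0 (by linarith)).trans_lt ?_⟩
      rw [abs_lt]
      constructor <;> linarith

end Conv

end LengthGraph

/-! ### From doubling constants to doubling dimensions -/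

section Dim

theorem doublingDim_le {X : Type*} {d : X → X → ℝ} {N : ℕ} (h : HasDoublingConstant d N) :
    doublingDim d ≤ ((Real.logb 2 (N : ℝ) : ℝ) : EReal) :=
  iInf₂_le N h

theorem HasDoublingConstant.one_le {X : Type*} [Nonempty X] {d : X → X → ℝ} {N : ℕ}
    (h : HasDoublingConstant d N) (hd : IsPseudoDist d) : 1 ≤ N := by
  obtain ⟨x⟩ := ‹Nonempty X›
  obtain ⟨S, hS, hc⟩ := h x 1 zero_le_one
  obtain ⟨y, hy, -⟩ := hc x (by rw [hd.self]; norm_num)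
  exact (Finset.card_pos.2 ⟨y, hy⟩).trans_le hS

/-- A real value of the dimension excludes `⊤`, so there is a least constant `N`. It is positive, so
the logarithm is monotone from `N` on. -/
theorem exists_hasDoublingConstant {X : Type*} [Nonempty X] {d : X → X → ℝ}
    (hd : IsPseudoDist d) {k : ℝ} (h : doublingDim d = (k : EReal)) :
    ∃ N : ℕ, 1 ≤ N ∧ HasDoublingConstant d N ∧ Real.logb 2 N ≤ k := by
  classical
  have hex : ∃ N, HasDoublingConstant d N := by
    by_contra! hno
    have : doublingDim d = ⊤ := by simp [doublingDim, hno]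
    rw [h] at this
    exact EReal.coe_ne_top k this
  have h1 := (Nat.find_spec hex).one_le hd
  refine ⟨Nat.find hex, h1, Nat.find_spec hex, ?_⟩
  rw [← EReal.coe_le_coe_iff, ← h]
  refine le_iInf₂ fun N hN => EReal.coe_le_coe_iff.2 ?_
  exact Real.logb_le_logb_of_le one_lt_two (by exact_mod_cast h1)
    (by exact_mod_cast Nat.find_min' hex hN)

theorem HasDoublingConstant.of_comparable {X : Type*} {d D : X → X → ℝ} {N : ℕ}
    (h : HasDoublingConstant d N) (h1 : ∀ u v, d u v ≤ D u v)
    (h2 : ∀ u v, D u v ≤ 3 / 2 * d u v) : HasDoublingConstant D (N ^ 2) := by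
  intro x r hr
  obtain ⟨S, hS, hc⟩ := h.iterate 2 x (r / 2) (by positivity)
  refine ⟨S, hS, fun z hz => ?_⟩
  obtain ⟨y, hy, hyz⟩ := hc z (by linarith [h1 x z])
  exact ⟨y, hy, by linarith [h2 y z]⟩

/-- Two points at positive distance would be a separated pair, against the packing bound `1 ^ 2`. -/
theorem HasDoublingConstant.eq_zero {X : Type*} {d : X → X → ℝ}
    (h : HasDoublingConstant d 1) (hd : IsPseudoDist d) (u v : X) : d u v = 0 := by
  classical
  by_contra hne
  have hpos : 0 < d u v := lt_of_le_of_ne (hd.nonneg u v) (Ne.symm hne)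
  have huv : u ≠ v := by rintro rfl; exact hne (hd.self u)
  have := h.card_le hd (A := {u, v}) (s := d u v) (c := u) 2 hpos (by
    intro a ha b hb hab
    simp only [Finset.mem_insert, Finset.mem_singleton] at ha hb
    rcases ha with rfl | rfl <;> rcases hb with rfl | rfl
    · exact absurd rfl hab
    · exact le_rfl
    · rw [hd.comm]
    · exact absurd rfl hab) (by
    intro a ha
    simp only [Finset.mem_insert, Finset.mem_singleton] at ha
    rcases ha with rfl | rfl
    · rw [hd.self]; positivity
    · linarith)
  rw [Finset.card_pair huv] at this
  omega

/-- Edges of length zero have no interior points. This settles dimension zero, where the bound to be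
proved is zero as well. -/
theorem LengthGraph.hasDoublingConstant_convDist_one {V : Type*} [LinearOrder V]
    {G : LengthGraph V} (hl : ∀ u v, G.len u v ≤ 0) (hd : ∀ u v, G.dist u v ≤ 0) :
    HasDoublingConstant G.convDist 1 := by
  have hno : ∀ q : EdgePoint G, False := fun q => by
    linarith [q.x_pos, q.x_lt, hl q.u q.v]
  intro x r hr
  refine ⟨{x}, by simp, fun z hz => ⟨x, by simp, ?_⟩⟩
  rcases hr.eq_or_lt with rfl | hr
  · simpa using hz
  cases x with
  | edge q => exact (hno q).elim
  | vertex w =>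
    cases z with
    | edge q => exact (hno q).elim
    | vertex w' => exact (hd w w').trans_lt hr

/-- With `L = logb 2 (1 / ε) ≥ 1` and `m` the ceiling of `logb 2 (100 / ε) ≤ 7 + L`, one gets `5 * m
+ 12 ≤ 52 + 5 * L ≤ 57 * L`. The exponent `5 * m + 12` is that of the doubling constant of the
closure. -/
theorem exists_two_pow_bound {ε : ℝ} (h0 : 0 < ε) (h1 : ε ≤ 1 / 2) :
    ∃ m : ℕ, 100 / ε ≤ 2 ^ m ∧ ((5 * m + 12 : ℕ) : ℝ) ≤ 57 * Real.logb 2 (1 / ε) := by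
  have hL : 1 ≤ Real.logb 2 (1 / ε) := by
    rw [Real.le_logb_iff_rpow_le one_lt_two (by positivity), Real.rpow_one, le_div_iff₀ h0]
    linarith
  have h100 : Real.logb 2 100 ≤ 7 := by
    rw [Real.logb_le_iff_le_rpow one_lt_two (by norm_num)]
    norm_num
  have hsplit : Real.logb 2 (100 / ε) = Real.logb 2 100 + Real.logb 2 (1 / ε) := by
    rw [← Real.logb_mul (by norm_num) (by positivity)]
    congr 1
    ring
  refine ⟨⌈Real.logb 2 (100 / ε)⌉₊, ?_, ?_⟩
  · have := Nat.le_ceil (Real.logb 2 (100 / ε))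
    rw [Real.logb_le_iff_le_rpow one_lt_two (by positivity), Real.rpow_natCast] at this
    exact this
  · have h100' : 0 ≤ Real.logb 2 100 := Real.logb_nonneg one_lt_two (by norm_num)
    have := (Nat.ceil_lt_add_one (a := Real.logb 2 (100 / ε)) (by linarith)).le
    push_cast
    linarith

variable {V : Type*} [Fintype V] [LinearOrder V] [Nonempty V] {d : V → V → ℝ} {R : V → ℝ}
  {B ε : ℝ} {rep : V → V → V}

theorem doublingDim_linkGraph_le (hd : IsPseudoDist d) (hR : IsNetRadius d R B)
    (hB : ∀ u v, d u v ≤ B) (h0 : 0 < ε) (h1 : ε ≤ 1 / 2)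
    (hrep : ∀ a b, Linked d R (100 / ε) a b → IsRep d R (100 / ε) a b (rep a b)) {k : ℝ}
    (hk : doublingDim d = (k : EReal)) :
    doublingDim (linkGraph hd R (100 / ε) rep).dist ≤ ((57 * k : ℝ) : EReal) ∧
    doublingDim (linkGraph hd R (100 / ε) rep).convDist ≤
      ((57 * k * Real.logb 2 (1 / ε) : ℝ) : EReal) := by
  have hT : 200 ≤ 100 / ε := by rw [le_div_iff₀ h0]; linarith
  set H := linkGraph hd R (100 / ε) rep with hH
  have hHc : H.graph.Connected := linkGraph_connected hd hR hB hT hrep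
  have hHl := le_dist_linkGraph hd hR hB hT hrep
  have hHu : ∀ u v, H.dist u v ≤ 3 / 2 * d u v := fun u v => by
    have := dist_linkGraph_le hd hR hB hT hrep u v
    have e : 100 / (100 / ε) = ε := by field_simp
    rw [e] at this
    nlinarith [hd.nonneg u v]
  obtain ⟨N, hN1, hN, hNk⟩ := exists_hasDoublingConstant hd hk
  have hlog : 0 ≤ Real.logb 2 (N : ℝ) := Real.logb_nonneg one_lt_two (by exact_mod_cast hN1)
  obtain ⟨m, hm, hm'⟩ := exists_two_pow_bound h0 h1
  constructor
  · refine (doublingDim_le (hN.of_comparable hHl hHu)).trans (EReal.coe_le_coe_iff.2 ?_)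
    push_cast
    rw [Real.logb_pow]
    push_cast
    linarith
  · have hL : 0 ≤ Real.logb 2 (1 / ε) := by
      have : (0 : ℝ) ≤ ((5 * m + 12 : ℕ) : ℝ) := by positivity
      linarith
    have hNm : HasDoublingConstant H.convDist (N ^ (5 * m + 12)) := by
      rcases hN1.eq_or_lt with rfl | hN2
      · rw [one_pow]
        have hz := hN.eq_zero hd
        exact LengthGraph.hasDoublingConstant_convDist_one (fun u v => (hz u v).le)
          fun u v => by linarith [hHu u v, hz u v]
      · have hcv := LengthGraph.hasDoublingConstant_convDist hHc hHl hHu hN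
          (fun r c F hr hF => card_linkGraph_long_edges_le hN hN1 hd hR hT hm hrep hr c hF)
        -- The numerical factor 35 is absorbed by `N ^ 6 ≥ 64`, which is why `N = 1` is treated
        -- apart.
        have hle : 2 * N ^ 4 + 6 * (5 * N ^ (5 * m + 6)) + 3 ≤ N ^ (5 * m + 12) := by
          have e1 : N ^ 4 ≤ N ^ (5 * m + 6) := Nat.pow_le_pow_right hN1 (by omega)
          have e2 : 1 ≤ N ^ (5 * m + 6) := Nat.one_le_pow _ _ hN1
          have e3 : 2 ^ 6 ≤ N ^ 6 := Nat.pow_le_pow_left hN2 6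
          calc 2 * N ^ 4 + 6 * (5 * N ^ (5 * m + 6)) + 3 ≤ N ^ (5 * m + 6) * 2 ^ 6 := by omega
            _ ≤ N ^ (5 * m + 6) * N ^ 6 := by gcongr
            _ = N ^ (5 * m + 12) := by rw [← pow_add]
        intro x r hr
        obtain ⟨S, hS, hc⟩ := hcv x r hr
        exact ⟨S, hS.trans hle, hc⟩
    refine (doublingDim_le hNm).trans (EReal.coe_le_coe_iff.2 ?_)
    push_cast
    rw [Real.logb_pow]
    calc ((5 * m + 12 : ℕ) : ℝ) * Real.logb 2 (N : ℝ)
        ≤ (57 * Real.logb 2 (1 / ε)) * Real.logb 2 (N : ℝ) := by gcongr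
      _ ≤ (57 * Real.logb 2 (1 / ε)) * k := by gcongr
      _ = 57 * k * Real.logb 2 (1 / ε) := by ring

end Dim

/-! ### Running times, frames and rules for loops -/

namespace RealRAM

/-- The running time of a program all of whose loops run at most `n` times, as a polynomial in
`n`. -/
noncomputable def Prog.timePoly : Prog → Polynomial ℕ
  | .skip => 1
  | .setNat _ i j e => Polynomial.C (i.cost + j.cost + e.cost + 1)
  | .setReal _ i j e => Polynomial.C (i.cost + j.cost + e.cost + 1)
  | .seq P Q => P.timePoly + Q.timePoly
  | .ite b P Q => Polynomial.C b.cost + (P.timePoly + Q.timePoly)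
  | .loop b P => Polynomial.C b.cost + Polynomial.X * (Polynomial.C b.cost + P.timePoly)

/-- The arrays of natural numbers to which a program may write. -/
def Prog.natArrays : Prog → List ℕ
  | .skip => []
  | .setNat a _ _ _ => [a]
  | .setReal _ _ _ _ => []
  | .seq P Q => P.natArrays ++ Q.natArrays
  | .ite _ P Q => P.natArrays ++ Q.natArrays
  | .loop _ P => P.natArrays

/-- The arrays of real numbers to which a program may write. -/
def Prog.realArrays : Prog → List ℕ
  | .skip => []
  | .setNat _ _ _ _ => []
  | .setReal a _ _ _ => [a]
  | .seq P Q => P.realArrays ++ Q.realArrays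
  | .ite _ P Q => P.realArrays ++ Q.realArrays
  | .loop _ P => P.realArrays

/-- The memories agree on the arrays to which `P` does not write. -/
structure Frame (P : Prog) (m m' : Mem) : Prop where
  nats : ∀ a, a ∉ P.natArrays → m'.nats a = m.nats a
  reals : ∀ a, a ∉ P.realArrays → m'.reals a = m.reals a

theorem Frame.refl (P : Prog) (m : Mem) : Frame P m m := ⟨fun _ _ => rfl, fun _ _ => rfl⟩

theorem Frame.trans {P : Prog} {m m' m'' : Mem} (h : Frame P m m') (h' : Frame P m' m'') :
    Frame P m m'' :=
  ⟨fun a ha => (h'.nats a ha).trans (h.nats a ha), fun a ha => (h'.reals a ha).trans (h.reals a ha)⟩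

theorem Frame.mono {P Q : Prog} {m m' : Mem} (h : Frame P m m') (hn : P.natArrays ⊆ Q.natArrays)
    (hr : P.realArrays ⊆ Q.realArrays) : Frame Q m m' :=
  ⟨fun a ha => h.nats a fun h => ha (hn h), fun a ha => h.reals a fun h => ha (hr h)⟩

/-- Reduces the question which data survive a subprogram to membership in an explicit list, settled
by `decide`. -/
theorem Exec.frame {P : Prog} {m m' : Mem} {t : ℕ} (h : Exec P m t m') : Frame P m m' := by
  induction h with
  | skip m => exact Frame.refl _ _
  | setNat m a i j e =>
    refine ⟨fun b hb => ?_, fun _ _ => rfl⟩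
    have : b ≠ a := by simpa [Prog.natArrays] using hb
    funext i' j'
    simp [Mem.writeNat, this]
  | setReal m a i j e =>
    refine ⟨fun _ _ => rfl, fun b hb => ?_⟩
    have : b ≠ a := by simpa [Prog.realArrays] using hb
    funext i' j'
    simp [Mem.writeReal, this]
  | seq _ _ ih ih' =>
    exact (ih.mono (by simp [Prog.natArrays]) (by simp [Prog.realArrays])).trans
      (ih'.mono (by simp [Prog.natArrays]) (by simp [Prog.realArrays]))
  | iteTrue _ _ ih => exact ih.mono (by simp [Prog.natArrays]) (by simp [Prog.realArrays])
  | iteFalse _ _ ih => exact ih.mono (by simp [Prog.natArrays]) (by simp [Prog.realArrays])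
  | loopStop _ => exact Frame.refl _ _
  | loopStep _ _ _ ih ih' =>
    exact (ih.mono (by simp [Prog.natArrays]) (by simp [Prog.realArrays])).trans ih'

/-- Started in `m`, the program halts within the time `P.timePoly` at `n` in a memory that
satisfies `Q`. -/
def Runs (n : ℕ) (P : Prog) (m : Mem) (Q : Mem → Prop) : Prop :=
  ∃ t m', Exec P m t m' ∧ t ≤ P.timePoly.eval n ∧ Q m'

namespace Runs

variable {n : ℕ} {P P' : Prog} {m : Mem} {Q Q' : Mem → Prop}

theorem mono (h : Runs n P m Q) (hQ : ∀ m', Frame P m m' → Q m' → Q' m') : Runs n P m Q' := by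
  obtain ⟨t, m', he, ht, hq⟩ := h
  exact ⟨t, m', he, ht, hQ m' he.frame hq⟩

theorem skip (h : Q m) : Runs n .skip m Q := ⟨1, m, .skip m, by simp [Prog.timePoly], h⟩

theorem setNat {a : ℕ} {i j e : NExp} (h : Q (m.writeNat a (i.eval m) (j.eval m) (e.eval m))) :
    Runs n (.setNat a i j e) m Q :=
  ⟨_, _, .setNat m a i j e, by simp [Prog.timePoly], h⟩

theorem setReal {a : ℕ} {i j : NExp} {e : RExp}
    (h : Q (m.writeReal a (i.eval m) (j.eval m) (e.eval m))) :
    Runs n (.setReal a i j e) m Q :=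
  ⟨_, _, .setReal m a i j e, by simp [Prog.timePoly], h⟩

theorem seq (h : Runs n P m fun m' => Frame P m m' → Runs n P' m' Q) :
    Runs n (.seq P P') m Q := by
  obtain ⟨t, m', he, ht, hq⟩ := h
  obtain ⟨t', m'', he', ht', hq'⟩ := hq he.frame
  exact ⟨t + t', m'', .seq he he', by simpa [Prog.timePoly] using add_le_add ht ht', hq'⟩

theorem ite {b : Test} (h : b.Holds m → Runs n P m Q) (h' : ¬ b.Holds m → Runs n P' m Q) :
    Runs n (.ite b P P') m Q := by
  by_cases hb : b.Holds m
  · obtain ⟨t, m', he, ht, hq⟩ := h hb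
    exact ⟨_, m', .iteTrue hb he, by simp [Prog.timePoly]; omega, hq⟩
  · obtain ⟨t, m', he, ht, hq⟩ := h' hb
    exact ⟨_, m', .iteFalse hb he, by simp [Prog.timePoly]; omega, hq⟩

end Runs

/-- The cell `(0, 0)` of an array of natural numbers. -/
def nvar (a : ℕ) : NExp := .read a (.const 0) (.const 0)

@[simp]
theorem nvar_eval (m : Mem) (a : ℕ) : (nvar a).eval m = m.nats a 0 0 := rfl

/-- Repeat `P` while the counter `c` runs from `0` to `n - 1`. -/
def forLoop (c : ℕ) (P : Prog) : Prog :=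
  .seq (.setNat c (.const 0) (.const 0) (.const 0))
    (.loop (.natLT (nvar c) (nvar 0))
      (.seq P (.setNat c (.const 0) (.const 0) (.add (nvar c) (.const 1)))))

theorem natArrays_forLoop (c : ℕ) (P : Prog) :
    (forLoop c P).natArrays = c :: (P.natArrays ++ [c]) := rfl

theorem realArrays_forLoop (c : ℕ) (P : Prog) :
    (forLoop c P).realArrays = P.realArrays ++ [] := rfl

/-- The body writes neither to the counter nor to the array that holds `n`, so it runs exactly `n`
times. By `hI` the invariant ignores the counter, and the frame given to `hstep` keeps untouched
data out of the invariant. -/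
theorem Runs.forLoop {n c : ℕ} {P : Prog} {m : Mem} (I : ℕ → Mem → Prop)
    (hc : c ≠ 0) (hcP : c ∉ P.natArrays) (h0P : 0 ∉ P.natArrays) (hn : m.nats 0 0 0 = n)
    (hI : ∀ k m x, I k m → I k (m.writeNat c 0 0 x)) (h0 : I 0 m)
    (hstep : ∀ k < n, ∀ m', Frame (RealRAM.forLoop c P) m m' → m'.nats c 0 0 = k →
      m'.nats 0 0 0 = n → I k m' → Runs n P m' (I (k + 1))) :
    Runs n (RealRAM.forLoop c P) m (I n) := by
  have key : ∀ j k m', k + j = n → Frame (RealRAM.forLoop c P) m m' → m'.nats c 0 0 = k → I k m' →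
      ∃ t m'', Exec (.loop (.natLT (nvar c) (nvar 0))
        (.seq P (.setNat c (.const 0) (.const 0) (.add (nvar c) (.const 1))))) m' t m'' ∧
        t ≤ (Test.natLT (nvar c) (nvar 0)).cost + j * ((Test.natLT (nvar c) (nvar 0)).cost +
          (Prog.seq P (.setNat c (.const 0) (.const 0)
            (.add (nvar c) (.const 1)))).timePoly.eval n) ∧ I n m'' := by
    intro j
    induction j with
    | zero =>
      intro k m' hk hF hck hIk
      have h0' : m'.nats 0 0 0 = n := by
        rw [hF.nats 0 (by simp [natArrays_forLoop, hc.symm, h0P]), hn]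
      refine ⟨_, m', .loopStop ?_, by simp, by rw [← hk]; exact hIk⟩
      simp [Test.Holds, hck, h0']
      omega
    | succ j ih =>
      intro k m' hk hF hck hIk
      have h0' : m'.nats 0 0 0 = n := by
        rw [hF.nats 0 (by simp [natArrays_forLoop, hc.symm, h0P]), hn]
      have hb : (Test.natLT (nvar c) (nvar 0)).Holds m' := by
        simp [Test.Holds, hck, h0']
        omega
      have hbody : Runs n (.seq P (.setNat c (.const 0) (.const 0) (.add (nvar c) (.const 1)))) m'
          fun m'' => m''.nats c 0 0 = k + 1 ∧ I (k + 1) m'' := by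
        refine Runs.seq ((hstep k (by omega) m' hF hck h0' hIk).mono fun m1 hF1 hI1 _ => ?_)
        apply Runs.setNat
        have e1 : m1.nats c 0 0 = k := by rw [hF1.nats c hcP, hck]
        refine ⟨?_, hI _ _ _ hI1⟩
        simp [Mem.writeNat, NExp.eval, e1]
      obtain ⟨s, m1, he, hs, hc1, hI1⟩ := hbody
      have hF1 : Frame (RealRAM.forLoop c P) m' m1 :=
        he.frame.mono (by simp [natArrays_forLoop, Prog.natArrays])
          (by simp [realArrays_forLoop, Prog.realArrays])
      obtain ⟨t, m2, he2, ht, hI2⟩ := ih (k + 1) m1 (by omega) (hF.trans hF1) hc1 hI1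
      refine ⟨_, m2, .loopStep hb he he2, ?_, hI2⟩
      rw [add_mul, one_mul]
      omega
  have hset : Exec (.setNat c (.const 0) (.const 0) (.const 0)) m _ _ :=
    .setNat m c (.const 0) (.const 0) (.const 0)
  obtain ⟨t, m', he, ht, hI'⟩ := key n 0 _ (by simp)
    (hset.frame.mono (Q := RealRAM.forLoop c P) (by simp [natArrays_forLoop, Prog.natArrays])
      (by simp [Prog.realArrays]))
    (by simp [Mem.writeNat, NExp.eval]) (hI _ _ _ h0)
  refine ⟨_, m', .seq hset he, ?_, hI'⟩
  simp only [RealRAM.forLoop, Prog.timePoly, Polynomial.eval_add, Polynomial.eval_mul,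
    Polynomial.eval_C, Polynomial.eval_X] at ht ⊢
  omega

/-- The rule for loops whose steps achieve independent goals: `K` is an invariant, `r` is a
preorder along which the memory moves, and the goals are monotone. -/
theorem Runs.forLoop_forall {n c : ℕ} {P : Prog} {m : Mem} {K : Mem → Prop}
    {r : Mem → Mem → Prop} {G : ℕ → Mem → Prop}
    (hc : c ≠ 0) (hcP : c ∉ P.natArrays) (h0P : 0 ∉ P.natArrays) (hn : m.nats 0 0 0 = n)
    (hK : ∀ m x, K m → K (m.writeNat c 0 0 x)) (hrr : ∀ m x, r m (m.writeNat c 0 0 x))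
    (hrt : ∀ m m' m'', r m m' → r m' m'' → r m m'')
    (hG : ∀ i m m', r m m' → G i m → G i m')
    (h0 : K m)
    (hstep : ∀ k < n, ∀ m', Frame (RealRAM.forLoop c P) m m' → m'.nats c 0 0 = k →
      m'.nats 0 0 0 = n → K m' → Runs n P m' fun m'' => K m'' ∧ r m' m'' ∧ G k m'') :
    Runs n (RealRAM.forLoop c P) m fun m' => K m' ∧ r m m' ∧ ∀ i < n, G i m' := by
  refine (Runs.forLoop (fun k m' => K m' ∧ r m m' ∧ ∀ i < k, G i m') hc hcP h0P hn ?_ ?_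
    ?_).mono fun m' _ h => h
  · rintro k m' x ⟨h1, h3, h4⟩
    exact ⟨hK _ _ h1, hrt _ _ _ h3 (hrr _ _), fun i hi => hG i _ _ (hrr _ _) (h4 i hi)⟩
  -- Writing the counter's own value back changes nothing, so `hrr` yields the reflexivity of `r`.
  · have e : m = m.writeNat c 0 0 (m.nats c 0 0) := by
      cases m
      simp only [Mem.writeNat, Mem.mk.injEq, and_true]
      funext a i j
      split_ifs with h
      · rw [h.1, h.2.1, h.2.2]
      · rfl
    refine ⟨h0, ?_, fun i hi => absurd hi (Nat.not_lt_zero i)⟩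
    have := hrr m (m.nats c 0 0)
    rwa [← e] at this
  · rintro k hk m' hF hck h0' ⟨h1, h3, h4⟩
    refine (hstep k hk m' hF hck h0' h1).mono fun m'' _ ⟨h5, h6, h7⟩ =>
      ⟨h5, hrt _ _ _ h3 h6, fun i hi => ?_⟩
    rcases Nat.lt_succ_iff_lt_or_eq.1 hi with h | rfl
    · exact hG i _ _ h6 (h4 i h)
    · exact h7

end RealRAM

/-! ### Computing the distances -/

namespace RealRAM

/-- The cell `(0, 0)` of an array of real numbers. -/
def rvar (a : ℕ) : RExp := .read a (.const 0) (.const 0)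

@[simp]
theorem rvar_eval (m : Mem) (a : ℕ) : (rvar a).eval m = m.reals a 0 0 := rfl

theorem writeReal_reals_of_ne {m : Mem} {a b i j : ℕ} {c : ℝ} (h : b ≠ a) :
    (m.writeReal a i j c).reals b = m.reals b := by
  funext i' j'
  simp [Mem.writeReal, h]

theorem writeNat_nats_of_ne {m : Mem} {a b i j : ℕ} {c : ℕ} (h : b ≠ a) :
    (m.writeNat a i j c).nats b = m.nats b := by
  funext i' j'
  simp [Mem.writeNat, h]

/-- Sum the entries of the real array `1`. -/
def sumProg : Prog :=
  forLoop 11 (forLoop 12 (.setReal 6 (.const 0) (.const 0)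
    (.add (rvar 6) (.read 1 (nvar 11) (nvar 12)))))

theorem runs_sumProg {n : ℕ} {m : Mem} (hn : m.nats 0 0 0 = n) (h6 : m.reals 6 0 0 = 0) :
    Runs n sumProg m fun m' =>
      m'.reals 6 0 0 = ∑ i ∈ Finset.range n, ∑ j ∈ Finset.range n, m.reals 1 i j := by
  refine Runs.forLoop (fun k m' => m'.reals 6 0 0 =
    ∑ i ∈ Finset.range k, ∑ j ∈ Finset.range n, m.reals 1 i j) (by decide) (by decide) (by decide)
    hn (fun _ _ _ h => h) (by simpa using h6) ?_
  intro k _ m' hF hk hn' hI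
  rw [Finset.sum_range_succ]
  refine Runs.forLoop (fun l m'' => m''.reals 6 0 0 =
    ∑ i ∈ Finset.range k, ∑ j ∈ Finset.range n, m.reals 1 i j +
      ∑ j ∈ Finset.range l, m.reals 1 k j) (by decide) (by decide) (by decide)
    hn' (fun _ _ _ h => h) (by simpa using hI) ?_
  intro l _ m'' hF' hl _ hI'
  apply Runs.setReal
  have h1 : m''.reals 1 = m.reals 1 := (hF'.reals 1 (by decide)).trans (hF.reals 1 (by decide))
  have h2 : m''.nats 11 = m'.nats 11 := hF'.nats 11 (by decide)
  simp [Mem.writeReal, NExp.eval, RExp.eval, hI', h1, h2, hk, hl, Finset.sum_range_succ, add_assoc]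

section Dist

variable {n : ℕ} (G : LengthGraph (Fin n))

/-- An admissible initial value for the distance of `u` and `v`. -/
def InitialBound (u v : Fin n) (x : ℝ) : Prop :=
  G.dist u v ≤ x ∧ (u = v → x ≤ 0) ∧ (G.graph.Adj u v → x ≤ G.len u v)

/-- Initialise the real array `3` by upper bounds for the distances. -/
def initDistProg : Prog :=
  forLoop 11 (forLoop 12
    (.ite (.and (.not (.natLT (nvar 11) (nvar 12))) (.not (.natLT (nvar 12) (nvar 11))))
      (.setReal 3 (nvar 11) (nvar 12) (.const 0))
      (.ite (.natLT (.const 0) (.read 1 (nvar 11) (nvar 12)))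
        (.setReal 3 (nvar 11) (nvar 12) (.read 1 (nvar 11) (nvar 12)))
        (.setReal 3 (nvar 11) (nvar 12) (rvar 6)))))

variable {G}

/-- The sum of all lengths plays the role of infinity for distinct vertices that are not adjacent.
-/
theorem runs_initDistProg {m : Mem} (hn : m.nats 0 0 0 = n)
    (hadj : ∀ u v : Fin n, 0 < m.nats 1 u v ↔ G.graph.Adj u v)
    (hlen : ∀ u v : Fin n, G.graph.Adj u v → m.reals 1 u v = G.len u v)
    (hB : ∀ u v : Fin n, G.dist u v ≤ m.reals 6 0 0) :
    Runs n initDistProg m fun m' => ∀ u v : Fin n, InitialBound G u v (m'.reals 3 u v) := by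
  refine (Runs.forLoop_forall (K := fun _ => True)
    (r := fun m m' => ∀ u v : Fin n, InitialBound G u v (m.reals 3 u v) →
      InitialBound G u v (m'.reals 3 u v))
    (G := fun i m => ∀ u v : Fin n, (u : ℕ) = i → InitialBound G u v (m.reals 3 u v))
    (by decide) (by decide) (by decide) hn (fun _ _ h => h) (fun _ _ _ _ h => h)
    (fun _ _ _ h h' u v huv => h' u v (h u v huv)) (fun _ _ _ h h' u v hu => h u v (h' u v hu))
    trivial ?_).mono fun m' _ h u v => h.2.2 u u.2 u v rfl
  intro k hk m1 hF1 hk1 hn1 _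
  refine (Runs.forLoop_forall (K := fun _ => True)
    (r := fun m m' => ∀ u v : Fin n, InitialBound G u v (m.reals 3 u v) →
      InitialBound G u v (m'.reals 3 u v))
    (G := fun j m => ∀ u v : Fin n, (u : ℕ) = k → (v : ℕ) = j → InitialBound G u v (m.reals 3 u v))
    (by decide) (by decide) (by decide) hn1 (fun _ _ h => h) (fun _ _ _ _ h => h)
    (fun _ _ _ h h' u v huv => h' u v (h u v huv))
    (fun _ _ _ h h' u v hu hv => h u v (h' u v hu hv))
    trivial ?_).mono fun m' _ h => ⟨trivial, h.2.1, fun u v hu => h.2.2 v v.2 u v hu rfl⟩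
  intro l hl m2 hF2 hl2 _ _
  have e1 : m2.reals 1 = m.reals 1 := (hF2.reals 1 (by decide)).trans (hF1.reals 1 (by decide))
  have e2 : m2.nats 1 = m.nats 1 := (hF2.nats 1 (by decide)).trans (hF1.nats 1 (by decide))
  have e3 : m2.reals 6 = m.reals 6 := (hF2.reals 6 (by decide)).trans (hF1.reals 6 (by decide))
  have e4 : m2.nats 11 0 0 = k := by rw [hF2.nats 11 (by decide), hk1]
  have key : ∀ x, InitialBound G ⟨k, hk⟩ ⟨l, hl⟩ x →
      True ∧ (∀ u v : Fin n, InitialBound G u v (m2.reals 3 u v) →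
        InitialBound G u v ((m2.writeReal 3 k l x).reals 3 u v)) ∧
      ∀ u v : Fin n, (u : ℕ) = k → (v : ℕ) = l →
        InitialBound G u v ((m2.writeReal 3 k l x).reals 3 u v) := by
    intro x hx
    have : ∀ u v : Fin n, (u : ℕ) = k → (v : ℕ) = l →
        InitialBound G u v ((m2.writeReal 3 k l x).reals 3 u v) := by
      rintro ⟨u, hu⟩ ⟨v, hv⟩ rfl rfl
      simpa [Mem.writeReal] using hx
    refine ⟨trivial, fun u v h => ?_, this⟩
    by_cases huv : (u : ℕ) = k ∧ (v : ℕ) = l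
    · exact this u v huv.1 huv.2
    · simpa [Mem.writeReal, huv] using h
  have ev : ∀ a : ℕ, (nvar a).eval m2 = m2.nats a 0 0 := fun _ => rfl
  refine Runs.ite (fun hb => ?_) fun hb => Runs.ite (fun hb' => ?_) fun hb' => ?_
  · apply Runs.setReal
    simp only [Test.Holds, ev, e4, hl2] at hb ⊢
    have hkl : k = l := by omega
    subst hkl
    apply key
    refine ⟨?_, fun _ => by simp [RExp.eval], fun h => (G.graph.loopless.irrefl _ h).elim⟩
    rw [G.dist_self]
    simp [RExp.eval]
  · apply Runs.setReal
    simp only [Test.Holds, NExp.eval, RExp.eval, ev, e4, hl2, e2, e1] at hb hb' ⊢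
    have ha := (hadj ⟨k, hk⟩ ⟨l, hl⟩).1 hb'
    apply key
    have hx := hlen _ _ ha
    simp only at hx
    rw [hx]
    exact ⟨G.dist_le_len ha, fun h => (ha.ne h).elim, fun _ => le_rfl⟩
  · apply Runs.setReal
    simp only [Test.Holds, NExp.eval, ev, rvar_eval, e4, hl2, e2, e3] at hb hb' ⊢
    apply key
    refine ⟨hB _ _, fun h => ?_, fun h => (hb' ((hadj _ _).2 h)).elim⟩
    rw [Fin.mk.injEq] at h
    omega

/-- Repeatedly shorten the entries of the real array `3` by the triangle inequality. -/
def relaxProg : Prog :=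
  forLoop 10 (forLoop 11 (forLoop 12 (forLoop 13
    (.ite (.realLT (.add (.read 3 (nvar 11) (nvar 12)) (.read 3 (nvar 12) (nvar 13)))
        (.read 3 (nvar 11) (nvar 13)))
      (.setReal 3 (nvar 11) (nvar 13)
        (.add (.read 3 (nvar 11) (nvar 12)) (.read 3 (nvar 12) (nvar 13))))
      .skip))))

/-- The real array `3` bounds the distances from above and, on walks with at most `k` edges, is
bounded by their lengths. -/
def ShortWalks (G : LengthGraph (Fin n)) (k : ℕ) (m : Mem) : Prop :=
  (∀ u v : Fin n, G.dist u v ≤ m.reals 3 u v) ∧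
    ∀ (u v : Fin n) (p : G.graph.Walk u v), p.length ≤ k → m.reals 3 u v ≤ G.walkLength p

/-- Each round relaxes all triples and thereby extends the walks accounted for by one first edge.
Updating in place in any order is harmless, because entries only decrease and never fall below the
distance. Walks with fewer than `n` edges suffice, so `n` rounds are enough. -/
theorem runs_relaxProg {m : Mem} (hn : m.nats 0 0 0 = n) (hG : G.graph.Connected)
    (h0 : ∀ u v : Fin n, InitialBound G u v (m.reals 3 u v)) :
    Runs n relaxProg m fun m' => ∀ u v : Fin n, m'.reals 3 u v = G.dist u v := by
  refine (Runs.forLoop (fun k m' => ShortWalks G (k + 1) m') (by decide) (by decide)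
    (by decide) hn (fun _ _ _ h => h) ?_ ?_).mono fun m' _ h u v => ?_
  · refine ⟨fun u v => (h0 u v).1, fun u v p hp => ?_⟩
    cases p with
    | nil => exact (h0 u u).2.1 rfl
    | cons h p =>
      cases p with
      | nil => simpa [LengthGraph.walkLength] using (h0 _ _).2.2 h
      | cons h' p => simp at hp
  · intro k _ m0 hF0 _ hn0 hI
    set r : Mem → Mem → Prop := fun m m' => ∀ u v : Fin n, m'.reals 3 u v ≤ m.reals 3 u v with hr
    have hrr : ∀ c, ∀ (m : Mem) x, r m (m.writeNat c 0 0 x) := fun _ _ _ _ _ => le_rfl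
    have hrt : ∀ m m' m'', r m m' → r m' m'' → r m m'' :=
      fun _ _ _ h h' u v => (h' u v).trans (h u v)
    set Done : ℕ → ℕ → ℕ → Mem → Prop := fun i j l m => ∀ (u v w : Fin n), (u : ℕ) = i →
      (v : ℕ) = j → (w : ℕ) = l → ∀ (h : G.graph.Adj u v) (p : G.graph.Walk v w),
      p.length ≤ k + 1 → m.reals 3 u w ≤ G.walkLength (.cons h p) with hDone
    have hmono : ∀ i j l m m', r m m' → Done i j l m → Done i j l m' :=
      fun i j l m m' h h' u v w hu hv hw ha p hp => (h u w).trans (h' u v w hu hv hw ha p hp)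
    refine (Runs.forLoop_forall (K := ShortWalks G (k + 1)) (r := r)
      (G := fun i m => ∀ j < n, ∀ l < n, Done i j l m) (by decide) (by decide) (by decide) hn0
      (fun _ _ h => h) (hrr _) hrt
      (fun i _ _ h h' j hj l hl => hmono i j l _ _ h (h' j hj l hl)) hI ?_).mono ?_
    · intro i hi m1 hF1 hi1 hn1 hI1
      refine Runs.forLoop_forall (K := ShortWalks G (k + 1)) (r := r)
        (G := fun j m => ∀ l < n, Done i j l m) (by decide) (by decide) (by decide) hn1
        (fun _ _ h => h) (hrr _) hrt (fun j _ _ h h' l hl => hmono i j l _ _ h (h' l hl)) hI1 ?_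
      intro j hj m2 hF2 hj2 hn2 hI2
      refine Runs.forLoop_forall (K := ShortWalks G (k + 1)) (r := r)
        (G := fun l m => Done i j l m) (by decide) (by decide) (by decide) hn2
        (fun _ _ h => h) (hrr _) hrt (fun l _ _ h h' => hmono i j l _ _ h h') hI2 ?_
      intro l hl m3 hF3 hl3 _ hI3
      have e1 : m3.nats 12 0 0 = j := by rw [hF3.nats 12 (by decide), hj2]
      have e2 : m3.nats 11 0 0 = i := by rw [hF3.nats 11 (by decide), hF2.nats 11 (by decide), hi1]
      have hdone : ∀ m4 : Mem, m4.reals 3 i l ≤ m3.reals 3 i j + m3.reals 3 j l →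
          Done i j l m4 := by
        rintro m4 h4 u v w rfl rfl rfl ha p hp
        rw [LengthGraph.walkLength_cons]
        refine h4.trans (add_le_add ?_ (hI3.2 v w p hp))
        have := hI3.2 u v (.cons ha .nil) (by simp)
        simpa [LengthGraph.walkLength] using this
      refine Runs.ite (fun hb => ?_) fun hb => ?_
      · apply Runs.setReal
        simp only [Test.Holds, RExp.eval, nvar_eval, e1, e2, hl3] at hb ⊢
        have hle : r m3 (m3.writeReal 3 i l (m3.reals 3 i j + m3.reals 3 j l)) := by
          intro u v
          by_cases huv : (u : ℕ) = i ∧ (v : ℕ) = l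
          · rw [← huv.1, ← huv.2] at hb ⊢
            simpa [Mem.writeReal] using hb.le
          · simp [Mem.writeReal, huv]
        refine ⟨⟨fun u v => ?_, fun u v p hp => (hle u v).trans (hI3.2 u v p hp)⟩, hle, ?_⟩
        · by_cases huv : (u : ℕ) = i ∧ (v : ℕ) = l
          · have h1 := G.dist_triangle hG u ⟨j, hj⟩ v
            have h2 := hI3.1 u ⟨j, hj⟩
            have h3 := hI3.1 ⟨j, hj⟩ v
            rw [← huv.1, ← huv.2]
            simp only [Mem.writeReal, and_self, if_true]
            linarith
          · simpa [Mem.writeReal, huv] using hI3.1 u v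
        · apply hdone
          simp [Mem.writeReal]
      · apply Runs.skip
        simp only [Test.Holds, RExp.eval, nvar_eval, e1, e2, hl3, not_lt] at hb
        exact ⟨hI3, fun _ _ => le_rfl, hdone _ hb⟩
    · rintro m' - ⟨h1, -, h3⟩
      refine ⟨h1.1, fun u v p hp => ?_⟩
      cases p with
      | nil => exact h1.2 u u .nil (by simp)
      | @cons _ v' _ h p =>
        exact h3 u u.2 v' v'.2 v v.2 u v' v rfl rfl rfl h p (by simpa using hp)
  · refine le_antisymm (LengthGraph.le_dist hG fun p => ?_) (h.1 u v)
    obtain ⟨q, hq, hqp⟩ := LengthGraph.exists_walk_length_lt (G := G) p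
    rw [Fintype.card_fin] at hq
    exact (h.2 u v q (by omega)).trans hqp

end Dist

end RealRAM

/-! ### Farthest point traversal -/

/-- The invariant of the farthest point traversal: `cur` is the distance to the points chosen so
far, which are those of positive radius. -/
structure GreedyInv {V : Type*} (d : V → V → ℝ) (B : ℝ) (cur R : V → ℝ) : Prop where
  cur_nonneg : ∀ v, 0 ≤ cur v
  cur_le : ∀ v, cur v ≤ B
  nonneg : ∀ v, 0 ≤ R v
  cur_le_of_ne : ∀ u, R u ≠ 0 → ∀ v, cur v ≤ d u v ∧ cur v ≤ R u
  sep : ∀ u v, u ≠ v → min (R u) (R v) ≤ d u v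
  cover : ∀ v s, cur v < s → s ≤ B → ∃ u, s ≤ R u ∧ d u v < s

namespace GreedyInv

variable {V : Type*} {d : V → V → ℝ} {B : ℝ} {cur R : V → ℝ}

theorem init (hd : IsPseudoDist d) (hB : 0 ≤ B) : GreedyInv d B (fun _ => B) (fun _ => 0) where
  cur_nonneg _ := hB
  cur_le _ := le_rfl
  nonneg _ := le_rfl
  cur_le_of_ne u h := absurd rfl h
  sep u v _ := by simpa using hd.nonneg u v
  cover v s h h' := absurd h' (not_le.2 h)

/-- The radius of a new point is its distance to the earlier ones, capped by `B`, which gives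
separation. If the new point brings `cur v` below `s` for the first time, then its radius is `cur b
≥ cur v ≥ s`, so it belongs to the net at scale `s` and covers `v`. -/
theorem step [DecidableEq V] (h : GreedyInv d B cur R) (hd : IsPseudoDist d) {b : V}
    (hb : 0 < cur b) (hmax : ∀ v, cur v ≤ cur b) :
    GreedyInv d B (fun v => min (cur v) (d b v)) (Function.update R b (cur b)) := by
  have hRb : R b = 0 := by
    by_contra hne
    have := (h.cur_le_of_ne b hne b).1
    rw [hd.self] at this
    linarith
  have hsep : ∀ v, v ≠ b → min (R v) (cur b) ≤ d v b := by
    intro v hv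
    by_cases h0 : R v = 0
    · exact (min_le_left _ _).trans (h0.le.trans (hd.nonneg _ _))
    · exact (min_le_right _ _).trans (h.cur_le_of_ne v h0 b).1
  refine ⟨fun v => le_min (h.cur_nonneg v) (hd.nonneg _ _),
    fun v => (min_le_left _ _).trans (h.cur_le v), fun v => ?_, fun u hu v => ?_,
    fun u v huv => ?_, fun v s hs hsB => ?_⟩
  · by_cases hv : v = b
    · subst hv; simpa using h.cur_nonneg v
    · simpa [hv] using h.nonneg v
  · by_cases hub : u = b
    · subst hub
      simpa using Or.inl (hmax v)
    · simp only [Function.update_of_ne hub] at hu ⊢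
      exact ⟨(min_le_left _ _).trans (h.cur_le_of_ne u hu v).1,
        (min_le_left _ _).trans (h.cur_le_of_ne u hu v).2⟩
  · by_cases hub : u = b
    · subst hub
      rw [Function.update_self, Function.update_of_ne huv.symm, min_comm, hd.comm]
      exact hsep v huv.symm
    · by_cases hvb : v = b
      · subst hvb
        rw [Function.update_self, Function.update_of_ne hub]
        exact hsep u hub
      · rw [Function.update_of_ne hub, Function.update_of_ne hvb]
        exact h.sep u v huv
  · by_cases hcs : cur v < s
    · obtain ⟨u, hu, hus⟩ := h.cover v s hcs hsB
      have hub : u ≠ b := by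
        rintro rfl
        linarith [h.cur_nonneg v]
      exact ⟨u, by rwa [Function.update_of_ne hub], hus⟩
    · push Not at hcs
      refine ⟨b, by simpa using hcs.trans (hmax v), ?_⟩
      rcases min_lt_iff.1 hs with h' | h'
      · exact absurd hcs (not_le.2 h')
      · exact h'

theorem isNetRadius (h : GreedyInv d B cur R) (h0 : ∀ v, cur v = 0) : IsNetRadius d R B :=
  ⟨h.nonneg, h.sep, fun s hs hsB v => h.cover v s (by rwa [h0]) hsB⟩

end GreedyInv

namespace RealRAM

variable {n : ℕ} {d : Fin n → Fin n → ℝ}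

/-- Find the index of a maximal entry of the real array `4`. -/
def argmaxProg : Prog :=
  .seq (.setNat 4 (.const 0) (.const 0) (.const 0))
    (forLoop 11 (.ite (.realLT (.read 4 (nvar 4) (.const 0)) (.read 4 (nvar 11) (.const 0)))
      (.setNat 4 (.const 0) (.const 0) (nvar 11)) .skip))

theorem runs_argmaxProg {m : Mem} (hn : m.nats 0 0 0 = n) (hpos : 0 < n) :
    Runs n argmaxProg m fun m' => ∃ b : Fin n, m'.nats 4 0 0 = b ∧
      ∀ v : Fin n, m.reals 4 v 0 ≤ m.reals 4 b 0 := by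
  refine Runs.seq (Runs.setNat fun hF => ?_)
  refine (Runs.forLoop (fun k m' => m'.nats 4 0 0 < n ∧
    ∀ i < k, m.reals 4 i 0 ≤ m.reals 4 (m'.nats 4 0 0) 0) (by decide) (by decide) (by decide)
    (by simpa [Mem.writeNat, NExp.eval] using hn) ?_ ?_ ?_).mono fun m' _ h =>
      ⟨⟨_, h.1⟩, rfl, fun v => h.2 v v.2⟩
  · intro k m' x h
    rwa [writeNat_nats_of_ne (by decide)]
  · simpa [Mem.writeNat, NExp.eval] using hpos
  · intro k hk m' hF' hk' _ h
    have e : m'.reals 4 = m.reals 4 := hF'.reals 4 (by decide)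
    refine Runs.ite (fun hb => ?_) fun hb => ?_
    · apply Runs.setNat
      simp only [Test.Holds, RExp.eval, NExp.eval, nvar_eval, hk', e] at hb ⊢
      simp only [Mem.writeNat, and_self, if_true]
      refine ⟨hk, fun i hi => ?_⟩
      rcases Nat.lt_succ_iff_lt_or_eq.1 hi with hi | rfl
      · exact (h.2 i hi).trans hb.le
      · exact le_rfl
    · apply Runs.skip
      simp only [Test.Holds, RExp.eval, NExp.eval, nvar_eval, hk', e, not_lt] at hb
      refine ⟨h.1, fun i hi => ?_⟩
      rcases Nat.lt_succ_iff_lt_or_eq.1 hi with hi | rfl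
      · exact h.2 i hi
      · exact hb

/-- Replace the entries of the real array `4` by their minimum with the distances from the
chosen point. -/
def updateProg : Prog :=
  forLoop 11 (.ite (.realLT (.read 3 (nvar 4) (nvar 11)) (.read 4 (nvar 11) (.const 0)))
    (.setReal 4 (nvar 11) (.const 0) (.read 3 (nvar 4) (nvar 11))) .skip)

theorem runs_updateProg {m : Mem} (hn : m.nats 0 0 0 = n) (b : ℕ) (hb : m.nats 4 0 0 = b) :
    Runs n updateProg m fun m' => ∀ i < n, m'.reals 4 i 0 = min (m.reals 4 i 0) (m.reals 3 b i) := by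
  refine (Runs.forLoop (fun k m' => (∀ i < k, m'.reals 4 i 0 =
      min (m.reals 4 i 0) (m.reals 3 b i)) ∧ ∀ i, k ≤ i → m'.reals 4 i 0 = m.reals 4 i 0)
    (by decide) (by decide) (by decide) hn (fun _ _ _ h => h)
    ⟨fun i hi => absurd hi (Nat.not_lt_zero i), fun _ _ => rfl⟩ ?_).mono fun m' _ h => h.1
  intro k hk m' hF hk' _ ⟨h1, h2⟩
  have e3 : m'.reals 3 = m.reals 3 := hF.reals 3 (by decide)
  have e4 : m'.nats 4 0 0 = b := by rw [hF.nats 4 (by decide), hb]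
  refine Runs.ite (fun ht => ?_) fun ht => ?_
  · apply Runs.setReal
    simp only [Test.Holds, RExp.eval, NExp.eval, nvar_eval, hk', e3, e4, h2 k le_rfl] at ht ⊢
    refine ⟨fun i hi => ?_, fun i hi => ?_⟩
    · by_cases hik : i = k
      · subst hik
        simp [Mem.writeReal, ht.le]
      · simpa [Mem.writeReal, hik] using h1 i (by omega)
    · have : i ≠ k := by omega
      simpa [Mem.writeReal, this] using h2 i (by omega)
  · apply Runs.skip
    simp only [Test.Holds, RExp.eval, NExp.eval, nvar_eval, hk', e3, e4, h2 k le_rfl, not_lt] at ht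
    refine ⟨fun i hi => ?_, fun i hi => h2 i (by omega)⟩
    by_cases hik : i = k
    · subst hik
      rw [h2 i le_rfl, min_eq_left ht]
    · exact h1 i (by omega)

/-- The farthest point traversal, which computes the net radii in the real array `5`. -/
def greedyProg : Prog :=
  .seq (forLoop 11 (.setReal 4 (nvar 11) (.const 0) (rvar 6)))
    (forLoop 10 (.seq argmaxProg
      (.ite (.realLT (.const 0) (.read 4 (nvar 4) (.const 0)))
        (.seq (.setReal 5 (nvar 4) (.const 0) (.read 4 (nvar 4) (.const 0))) updateProg)
        .skip)))

/-- Every effective round makes at least one more entry of `cur` vanish, so after `n` rounds all of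
them are zero. Vertices at distance zero from a chosen one are never chosen and keep radius zero. -/
theorem runs_greedyProg {m : Mem} (hn : m.nats 0 0 0 = n) (hpos : 0 < n) (hd : IsPseudoDist d)
    (hD : ∀ u v : Fin n, m.reals 3 u v = d u v) (hB : 0 ≤ m.reals 6 0 0)
    (hR : ∀ v : Fin n, m.reals 5 v 0 = 0) :
    Runs n greedyProg m fun m' =>
      IsNetRadius d (fun v : Fin n => m'.reals 5 v 0) (m.reals 6 0 0) := by
  classical
  have hinit : Runs n (forLoop 11 (.setReal 4 (nvar 11) (.const 0) (rvar 6))) m fun m' =>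
      ∀ i < n, m'.reals 4 i 0 = m.reals 6 0 0 := by
    refine Runs.forLoop (fun k m' => ∀ i < k, m'.reals 4 i 0 = m.reals 6 0 0) (by decide)
      (by decide) (by decide) hn (fun _ _ _ h => h)
      (fun i hi => absurd hi (Nat.not_lt_zero i)) ?_
    intro k hk m' hF hk' _ h
    apply Runs.setReal
    have e : m'.reals 6 = m.reals 6 := hF.reals 6 (by decide)
    intro i hi
    by_cases hik : i = k
    · simp [Mem.writeReal, NExp.eval, hik, hk', e]
    · simpa [Mem.writeReal, NExp.eval, hik, hk'] using h i (by omega)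
  refine Runs.seq (hinit.mono fun m1 _ h1 hF1 => ?_)
  set B := m.reals 6 0 0 with hBdef
  have hn1 : m1.nats 0 0 0 = n := by rw [hF1.nats 0 (by decide), hn]
  have h13 : m1.reals 3 = m.reals 3 := hF1.reals 3 (by decide)
  have h15 : m1.reals 5 = m.reals 5 := hF1.reals 5 (by decide)
  refine (Runs.forLoop (fun k m' =>
    GreedyInv d B (fun v : Fin n => m'.reals 4 v 0) (fun v : Fin n => m'.reals 5 v 0) ∧
    ((∀ v : Fin n, m'.reals 4 v 0 = 0) ∨
      k ≤ (Finset.univ.filter fun v : Fin n => m'.reals 4 v 0 = 0).card)) (by decide) (by decide)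
    (by decide) hn1 (fun _ _ _ h => h) ?_ ?_).mono fun m' _ h => ?_
  · have e1 : (fun v : Fin n => m1.reals 4 v 0) = fun _ => B := funext fun v => h1 v v.2
    have e2 : (fun v : Fin n => m1.reals 5 v 0) = fun _ => 0 := funext fun v => by rw [h15, hR]
    rw [e1, e2]
    exact ⟨GreedyInv.init hd hB, Or.inr (Nat.zero_le _)⟩
  · intro k hk m2 hF2 _ hn2 ⟨hI, hcard⟩
    refine Runs.seq ((runs_argmaxProg hn2 hpos).mono ?_)
    rintro m3 - ⟨b, hb, hmax⟩ hF3
    have e34 : m3.reals 4 = m2.reals 4 := hF3.reals 4 (by decide)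
    have e35 : m3.reals 5 = m2.reals 5 := hF3.reals 5 (by decide)
    have e33 : m3.reals 3 = m.reals 3 := by
      rw [hF3.reals 3 (by decide), hF2.reals 3 (by decide), h13]
    have hn3 : m3.nats 0 0 0 = n := by rw [hF3.nats 0 (by decide), hn2]
    refine Runs.ite (fun ht => ?_) fun ht => ?_
    · simp only [Test.Holds, RExp.eval, NExp.eval, nvar_eval, hb, Nat.cast_zero] at ht
      refine Runs.seq (Runs.setReal fun _ => ?_)
      simp only [RExp.eval, NExp.eval, nvar_eval, hb]
      refine (runs_updateProg (m := m3.writeReal 5 b 0 (m3.reals 4 b 0)) hn3 b hb).mono fun m4 hF4 h4 => ?_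
      have e4 : (fun v : Fin n => m4.reals 4 v 0) =
          fun v : Fin n => min (m2.reals 4 v 0) (d b v) := by
        funext v
        rw [h4 v v.2, writeReal_reals_of_ne (by decide), writeReal_reals_of_ne (by decide), e34,
          e33, hD]
      have e5 : (fun v : Fin n => m4.reals 5 v 0) =
          Function.update (fun v : Fin n => m2.reals 5 v 0) b (m2.reals 4 b 0) := by
        funext v
        rw [hF4.reals 5 (by decide)]
        by_cases hvb : v = b
        · subst hvb
          simp [Mem.writeReal, e34]
        · have : (v : ℕ) ≠ b := fun h => hvb (Fin.ext h)
          simp [Mem.writeReal, hvb, this, e35]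
      have ht' : 0 < m2.reals 4 b 0 := by rwa [e34] at ht
      rw [e4, e5]
      refine ⟨hI.step hd ht' hmax, Or.inr ?_⟩
      have hk' : k ≤ (Finset.univ.filter fun v : Fin n => m2.reals 4 v 0 = 0).card :=
        hcard.resolve_left fun h => ht'.ne' (h b)
      refine Nat.succ_le_of_lt (hk'.trans_lt (Finset.card_lt_card ?_))
      have e4' : ∀ v : Fin n, m4.reals 4 v 0 = min (m2.reals 4 v 0) (d b v) := congrFun e4
      refine ⟨fun v hv => ?_, fun hsub => ?_⟩
      · simp only [Finset.mem_filter, Finset.mem_univ, true_and] at hv ⊢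
        rw [e4', hv, min_eq_left (hd.nonneg _ _)]
      · have := @hsub b (by
          simp only [Finset.mem_filter, Finset.mem_univ, true_and]
          rw [e4', hd.self, min_eq_right ht'.le])
        simp only [Finset.mem_filter, Finset.mem_univ, true_and] at this
        exact ht'.ne' this
    · apply Runs.skip
      simp only [Test.Holds, RExp.eval, NExp.eval, nvar_eval, hb, Nat.cast_zero, not_lt] at ht
      rw [e34] at ht
      rw [e34, e35]
      exact ⟨hI, Or.inl fun v => le_antisymm ((hmax v).trans ht) (hI.cur_nonneg v)⟩
  · refine h.1.isNetRadius ?_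
    rcases h.2 with h2 | h2
    · exact h2
    · intro v
      have : (Finset.univ.filter fun v : Fin n => m'.reals 4 v 0 = 0) = Finset.univ :=
        Finset.eq_univ_of_card _ (le_antisymm (Finset.card_le_univ _) (by simpa using h2))
      have hv := Finset.mem_univ v
      rw [← this] at hv
      exact (Finset.mem_filter.1 hv).2

end RealRAM

/-! ### Computing the representatives and writing the output -/

namespace RealRAM

/-- The test whether two natural numbers are equal. -/
def natEq (e f : NExp) : Test := .and (.not (.natLT e f)) (.not (.natLT f e))

theorem holds_natEq {m : Mem} {e f : NExp} : (natEq e f).Holds m ↔ e.eval m = f.eval m := by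
  simp only [natEq, Test.Holds]
  omega

/-- The number `100 / ε`. -/
def ratioExp : RExp := .div (.const 100) (rvar 0)

theorem ratioExp_eval (m : Mem) : ratioExp.eval m = 100 / m.reals 0 0 0 := by
  simp [ratioExp, RExp.eval]

/-- The test whether the current vertex `13` should replace the current candidate. -/
def betterTest : Test :=
  .and (.not (natEq (nvar 13) (nvar 11)))
    (.and (.not (.realLT (.mul ratioExp (.read 5 (nvar 13) (.const 0)))
      (.read 3 (nvar 11) (nvar 13))))
    (.and (.realLT (.mul (.mul ratioExp ratioExp) (.read 5 (nvar 13) (.const 0)))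
      (.read 5 (nvar 12) (.const 0)))
    (.not (.and (.not (natEq (nvar 4) (nvar 11)))
      (.not (.realLT (.read 5 (nvar 4) (.const 0)) (.read 5 (nvar 13) (.const 0))))))))

/-- Find the representative of the vertex `11` for the vertex `12`. -/
def bestProg : Prog :=
  .seq (.setNat 4 (.const 0) (.const 0) (nvar 11))
    (forLoop 13 (.ite betterTest (.setNat 4 (.const 0) (.const 0) (nvar 13)) .skip))

variable {n : ℕ} {d : Fin n → Fin n → ℝ} {R : Fin n → ℝ} {T : ℝ}

/-- The memory holds the distances, the radii and `ε`. -/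
structure HoldsNet (d : Fin n → Fin n → ℝ) (R : Fin n → ℝ) (T : ℝ) (m : Mem) : Prop where
  size : m.nats 0 0 0 = n
  dist : ∀ u v : Fin n, m.reals 3 u v = d u v
  radius : ∀ v : Fin n, m.reals 5 v 0 = R v
  ratio : 100 / m.reals 0 0 0 = T

theorem HoldsNet.of_frame {m m' : Mem} {P : Prog} (h : HoldsNet d R T m) (hF : Frame P m m')
    (h0 : 0 ∉ P.natArrays) (h0' : 0 ∉ P.realArrays) (h3 : 3 ∉ P.realArrays)
    (h5 : 5 ∉ P.realArrays) : HoldsNet d R T m' :=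
  ⟨by rw [hF.nats 0 h0, h.size], by rw [hF.reals 3 h3]; exact h.dist,
    by rw [hF.reals 5 h5]; exact h.radius, by rw [hF.reals 0 h0', h.ratio]⟩

/-- The value `a` doubles as the mark that no candidate has been met yet, which is unambiguous
because candidates differ from `a`. -/
theorem runs_bestProg {m : Mem} (h : HoldsNet d R T m) {a b : Fin n} (ha : m.nats 11 0 0 = a)
    (hb : m.nats 12 0 0 = b) :
    Runs n bestProg m fun m' => ∃ x : Fin n, m'.nats 4 0 0 = x ∧ IsRep d R T a b x := by
  refine Runs.seq (Runs.setNat fun hF => ?_)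
  have h1 := h.of_frame hF (by decide) (by decide) (by decide) (by decide)
  refine (Runs.forLoop (fun k m' => ∃ x : Fin n, m'.nats 4 0 0 = x ∧
    ((x = a ∧ ∀ q : Fin n, (q : ℕ) < k → ¬ Substitute d R T a b q) ∨
      (Substitute d R T a b x ∧
        ∀ q : Fin n, (q : ℕ) < k → Substitute d R T a b q → R q ≤ R x)))
    (by decide) (by decide) (by decide) h1.size ?_ ?_ ?_).mono ?_
  · intro k m' x hx
    rwa [writeNat_nats_of_ne (by decide)]
  · exact ⟨a, by simp [Mem.writeNat, NExp.eval, ha],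
      Or.inl ⟨rfl, fun q hq => absurd hq (Nat.not_lt_zero _)⟩⟩
  · rintro k hk m' hF' hk' - ⟨x, hx, hI⟩
    have h2 := h1.of_frame hF' (by decide) (by decide) (by decide) (by decide)
    have ea : m'.nats 11 0 0 = a := by rw [hF'.nats 11 (by decide), hF.nats 11 (by decide), ha]
    have eb : m'.nats 12 0 0 = b := by rw [hF'.nats 12 (by decide), hF.nats 12 (by decide), hb]
    obtain ⟨q, rfl⟩ : ∃ q : Fin n, (q : ℕ) = k := ⟨⟨k, hk⟩, rfl⟩
    have htest : betterTest.Holds m' ↔ Substitute d R T a b q ∧ (x = a ∨ R x < R q) := by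
      simp only [betterTest, Test.Holds, holds_natEq, RExp.eval, NExp.eval, nvar_eval,
        ratioExp_eval, h2.ratio, h2.dist, h2.radius, ea, eb, hk', hx, Substitute, Fin.val_inj,
        not_lt, not_and, not_not, ← pow_two, and_assoc, imp_iff_not_or, not_le, ne_eq]
    have hlt : ∀ q' : Fin n, (q' : ℕ) < q + 1 → (q' : ℕ) < q ∨ q' = q := fun q' h => by
      rcases Nat.lt_succ_iff_lt_or_eq.1 h with h | h
      · exact Or.inl h
      · exact Or.inr (Fin.ext h)
    refine Runs.ite (fun ht => ?_) fun ht => ?_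
    · obtain ⟨hs, hbet⟩ := htest.1 ht
      apply Runs.setNat
      refine ⟨q, by simp [Mem.writeNat, NExp.eval, hk'], Or.inr ⟨hs, fun q' hq' hs' => ?_⟩⟩
      rcases hlt q' hq' with hq' | rfl
      · rcases hI with ⟨-, h3⟩ | ⟨h3, h4⟩
        · exact absurd hs' (h3 q' hq')
        · exact (h4 q' hq' hs').trans (hbet.resolve_left h3.1).le
      · exact le_rfl
    · rw [htest] at ht
      apply Runs.skip
      refine ⟨x, hx, ?_⟩
      rcases hI with ⟨h3, h4⟩ | ⟨h3, h4⟩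
      · refine Or.inl ⟨h3, fun q' hq' hs' => ?_⟩
        rcases hlt q' hq' with hq' | rfl
        · exact h4 q' hq' hs'
        · exact ht ⟨hs', Or.inl h3⟩
      · refine Or.inr ⟨h3, fun q' hq' hs' => ?_⟩
        rcases hlt q' hq' with hq' | rfl
        · exact h4 q' hq' hs'
        · by_contra hR
          exact ht ⟨hs', Or.inr (not_le.1 hR)⟩
  · rintro m' - ⟨x, hx, hI⟩
    exact ⟨x, hx, hI.imp (fun h => ⟨h.1, fun q => h.2 q q.2⟩) fun h => ⟨h.1, fun q => h.2 q q.2⟩⟩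

/-- Compute the table of all representatives in the array `5`. -/
def repProg : Prog :=
  forLoop 11 (forLoop 12 (.seq bestProg (.setNat 5 (nvar 11) (nvar 12) (nvar 4))))

theorem runs_repProg {m : Mem} (h : HoldsNet d R T m) :
    Runs n repProg m fun m' => ∀ a b : Fin n,
      ∃ x : Fin n, m'.nats 5 a b = x ∧ IsRep d R T a b x := by
  set r : Mem → Mem → Prop := fun m m' => ∀ a b : Fin n,
    (∃ x : Fin n, m.nats 5 a b = x ∧ IsRep d R T a b x) →
      ∃ x : Fin n, m'.nats 5 a b = x ∧ IsRep d R T a b x with hr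
  have hrr : ∀ c, 5 ≠ c → ∀ (m : Mem) x, r m (m.writeNat c 0 0 x) := fun c hc m x a b h => by
    rwa [writeNat_nats_of_ne hc]
  have hrt : ∀ m m' m'', r m m' → r m' m'' → r m m'' := fun _ _ _ h h' a b hab => h' a b (h a b hab)
  refine (Runs.forLoop_forall (K := fun _ => True) (r := r)
    (G := fun i m => ∀ a b : Fin n, (a : ℕ) = i →
      ∃ x : Fin n, m.nats 5 a b = x ∧ IsRep d R T a b x)
    (by decide) (by decide) (by decide) h.size (fun _ _ h => h) (hrr _ (by decide)) hrt
    (fun _ _ _ h h' a b hi => h a b (h' a b hi)) trivial ?_).mono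
      fun m' _ h a b => h.2.2 a a.2 a b rfl
  intro i hi m1 hF1 hi1 hn1 _
  refine (Runs.forLoop_forall (K := fun _ => True) (r := r)
    (G := fun j m => ∀ a b : Fin n, (a : ℕ) = i → (b : ℕ) = j →
      ∃ x : Fin n, m.nats 5 a b = x ∧ IsRep d R T a b x)
    (by decide) (by decide) (by decide) hn1 (fun _ _ h => h) (hrr _ (by decide)) hrt
    (fun _ _ _ h h' a b hi hj => h a b (h' a b hi hj)) trivial ?_).mono
      fun m' _ h => ⟨trivial, h.2.1, fun a b hi => h.2.2 b b.2 a b hi rfl⟩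
  intro j hj m2 hF2 hj2 _ _
  have h2 := (h.of_frame hF1 (by decide) (by decide) (by decide) (by decide)).of_frame hF2
    (by decide) (by decide) (by decide) (by decide)
  have e2 : m2.nats 11 0 0 = i := by rw [hF2.nats 11 (by decide), hi1]
  refine Runs.seq ((runs_bestProg h2 (a := ⟨i, hi⟩) (b := ⟨j, hj⟩) e2 hj2).mono ?_)
  rintro m3 - ⟨x, hx, hrep⟩ hF3
  apply Runs.setNat
  have e3 : m3.nats 11 0 0 = i := by rw [hF3.nats 11 (by decide), e2]
  have e3' : m3.nats 12 0 0 = j := by rw [hF3.nats 12 (by decide), hj2]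
  have e5 : m3.nats 5 = m2.nats 5 := hF3.nats 5 (by decide)
  simp only [nvar_eval, e3, e3', hx]
  have key : ∀ a b : Fin n, (a : ℕ) = i → (b : ℕ) = j →
      ∃ y : Fin n, (m3.writeNat 5 i j x).nats 5 a b = y ∧ IsRep d R T a b y := by
    rintro ⟨a, ha⟩ ⟨b, hb⟩ rfl rfl
    exact ⟨x, by simp [Mem.writeNat], hrep⟩
  refine ⟨trivial, fun a b hab => ?_, key⟩
  by_cases hij : (a : ℕ) = i ∧ (b : ℕ) = j
  · exact key a b hij.1 hij.2
  · simpa [Mem.writeNat, hij, e5] using hab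

/-- The test whether the vertex `12` is linked to the vertex `11`. -/
def linkedTest : Test :=
  .and (.not (natEq (nvar 11) (nvar 12)))
    (.and (.not (.realLT (.read 5 (nvar 11) (.const 0)) (.read 5 (nvar 12) (.const 0))))
    (.not (.realLT (.mul ratioExp (.read 5 (nvar 12) (.const 0)))
      (.read 3 (nvar 11) (nvar 12)))))

/-- Write one directed edge to the output. -/
def writeEdge (i j : NExp) : Prog :=
  .seq (.setNat 2 i j (.const 1)) (.setReal 2 i j (.read 3 i j))

/-- Write all edges to the output. -/
def outputProg : Prog :=
  forLoop 11 (forLoop 12 (.ite linkedTest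
    (.seq (writeEdge (.read 5 (nvar 11) (nvar 12)) (nvar 12))
      (writeEdge (nvar 12) (.read 5 (nvar 11) (nvar 12)))) .skip))

/-- The output written so far consists of edges of `H`. -/
def PartialOutput (H : LengthGraph (Fin n)) (m : Mem) : Prop :=
  ∀ u v : Fin n, m.nats 2 u v = 1 → H.graph.Adj u v ∧ m.reals 2 u v = H.len u v

/-- The index expressions are evaluated again after the adjacency entry has been written, so their
values must not depend on the array `2`. -/
theorem runs_writeEdge {H : LengthGraph (Fin n)} {m : Mem} {i j : NExp} {u v : Fin n}
    (hi : ∀ m', (∀ a, a ≠ 2 → m'.nats a = m.nats a) → i.eval m' = u)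
    (hj : ∀ m', (∀ a, a ≠ 2 → m'.nats a = m.nats a) → j.eval m' = v)
    (hadj : H.graph.Adj u v) (hlen : m.reals 3 u v = H.len u v) (hm : PartialOutput H m) :
    Runs n (writeEdge i j) m fun m' => PartialOutput H m' ∧
      (∀ a b : Fin n, m.nats 2 a b = 1 → m'.nats 2 a b = 1) ∧ m'.nats 2 u v = 1 := by
  refine Runs.seq (Runs.setNat fun _ => Runs.setReal ?_)
  rw [hi m fun _ _ => rfl, hj m fun _ _ => rfl]
  have hfr : ∀ a, a ≠ 2 → (m.writeNat 2 u v 1).nats a = m.nats a :=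
    fun a ha => writeNat_nats_of_ne ha
  simp only [NExp.eval, RExp.eval]
  rw [hi _ hfr, hj _ hfr]
  refine ⟨fun a b hab => ?_, fun a b hab => ?_, ?_⟩
  · by_cases h : (a : ℕ) = u ∧ (b : ℕ) = v
    · obtain rfl := Fin.ext h.1
      obtain rfl := Fin.ext h.2
      refine ⟨hadj, ?_⟩
      simpa [Mem.writeNat, Mem.writeReal] using hlen
    · have := hm a b (by simpa [Mem.writeNat, Mem.writeReal, h] using hab)
      simpa [Mem.writeNat, Mem.writeReal, h] using this
  · simp only [Mem.writeNat, Mem.writeReal]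
    split_ifs
    exacts [rfl, hab]
  · simp [Mem.writeNat, Mem.writeReal]

/-- An edge may arise from several links. Writing it again does no harm: adjacency entries are only
ever set to 1, and the length depends only on the ends. -/
theorem runs_outputProg {m : Mem} (h : HoldsNet d R T m) (hd : IsPseudoDist d)
    {rep : Fin n → Fin n → Fin n} (hrep : ∀ a b : Fin n, m.nats 5 a b = rep a b)
    (hne : ∀ a b, Linked d R T a b → rep a b ≠ b)
    (h2 : ∀ u v : Fin n, m.nats 2 u v = 0) :
    Runs n outputProg m fun m' => HoldsOutput m' (linkGraph hd R T rep) := by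
  set H := linkGraph hd R T rep with hH
  set r : Mem → Mem → Prop := fun m m' => ∀ u v : Fin n, m.nats 2 u v = 1 → m'.nats 2 u v = 1
    with hr
  set Done : ℕ → ℕ → Mem → Prop := fun i j m => ∀ a b : Fin n, (a : ℕ) = i → (b : ℕ) = j →
    Linked d R T a b → m.nats 2 (rep a b) b = 1 ∧ m.nats 2 b (rep a b) = 1 with hDone
  have hmono : ∀ i j m m', r m m' → Done i j m → Done i j m' := fun i j m m' hm hD a b ha hb hl =>
    ⟨hm _ _ (hD a b ha hb hl).1, hm _ _ (hD a b ha hb hl).2⟩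
  have hK : ∀ c, 2 ≠ c → ∀ (m : Mem) x, PartialOutput H m → PartialOutput H (m.writeNat c 0 0 x) :=
    fun c hc m x hm u v huv => by
      rw [writeNat_nats_of_ne hc] at huv
      exact hm u v huv
  have hrr : ∀ c, 2 ≠ c → ∀ (m : Mem) x, r m (m.writeNat c 0 0 x) := fun c hc m x u v huv => by
    rwa [writeNat_nats_of_ne hc]
  have hrt : ∀ m m' m'', r m m' → r m' m'' → r m m'' := fun _ _ _ h h' u v huv => h' u v (h u v huv)
  refine (Runs.forLoop_forall (K := PartialOutput H) (r := r)
    (G := fun i m => ∀ j < n, Done i j m)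
    (by decide) (by decide) (by decide) h.size (hK _ (by decide)) (hrr _ (by decide)) hrt
    (fun i _ _ hm hD j hj => hmono i j _ _ hm (hD j hj))
    (fun u v huv => by rw [h2] at huv; exact absurd huv zero_ne_one) ?_).mono ?_
  · intro i hi m1 hF1 hi1 hn1 hI1
    refine Runs.forLoop_forall (K := PartialOutput H) (r := r)
      (G := fun j m => Done i j m)
      (by decide) (by decide) (by decide) hn1 (hK _ (by decide)) (hrr _ (by decide)) hrt
      (fun j _ _ hm hD => hmono i j _ _ hm hD) hI1 ?_
    intro j hj m2 hF2 hj2 _ hI2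
    obtain ⟨a, rfl⟩ : ∃ a : Fin n, (a : ℕ) = i := ⟨⟨i, hi⟩, rfl⟩
    obtain ⟨b, rfl⟩ : ∃ b : Fin n, (b : ℕ) = j := ⟨⟨j, hj⟩, rfl⟩
    have e2 : m2.nats 11 0 0 = a := by rw [hF2.nats 11 (by decide), hi1]
    have h3 := (h.of_frame hF1 (by decide) (by decide) (by decide) (by decide)).of_frame hF2
      (by decide) (by decide) (by decide) (by decide)
    have e5 : m2.nats 5 a b = rep a b := by
      rw [hF2.nats 5 (by decide), hF1.nats 5 (by decide), hrep]
    have htest : linkedTest.Holds m2 ↔ Linked d R T a b := by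
      simp only [linkedTest, Test.Holds, holds_natEq, RExp.eval, NExp.eval, nvar_eval,
        ratioExp_eval, h3.ratio, h3.dist, h3.radius, e2, hj2, Linked, Fin.val_inj, not_lt, ne_eq]
    refine Runs.ite (fun ht => ?_) fun ht => ?_
    · rw [htest] at ht
      have hadj : H.graph.Adj (rep a b) b := ⟨hne a b ht, a, b, ht, Or.inl ⟨rfl, rfl⟩⟩
      have hx : ∀ m' : Mem, (∀ c, c ≠ 2 → m'.nats c = m2.nats c) →
          (NExp.read 5 (nvar 11) (nvar 12)).eval m' = rep a b := by
        intro m' hm'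
        simp only [NExp.eval, nvar_eval, hm' 5 (by decide), hm' 11 (by decide),
          hm' 12 (by decide), e2, hj2, e5]
      have hb : ∀ m' : Mem, (∀ c, c ≠ 2 → m'.nats c = m2.nats c) → (nvar 12).eval m' = b := by
        intro m' hm'
        rw [nvar_eval, hm' 12 (by decide), hj2]
      refine Runs.seq ((runs_writeEdge hx hb hadj (h3.dist _ _) hI2).mono ?_)
      rintro m3 hF3 ⟨hI3, hr3, hw3⟩ -
      have hfr : ∀ c, c ≠ 2 → m3.nats c = m2.nats c := fun c hc =>
        hF3.nats c (by simpa [writeEdge, Prog.natArrays] using hc)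
      refine (runs_writeEdge (fun m' hm' => hb m' fun c hc => (hm' c hc).trans (hfr c hc))
        (fun m' hm' => hx m' fun c hc => (hm' c hc).trans (hfr c hc)) hadj.symm
        (by rw [hF3.reals 3 (by decide)]; exact h3.dist _ _) hI3).mono ?_
      rintro m4 - ⟨hI4, hr4, hw4⟩
      refine ⟨hI4, hrt _ _ _ hr3 hr4, fun a' b' ha' hb' _ => ?_⟩
      obtain rfl := Fin.ext ha'
      obtain rfl := Fin.ext hb'
      exact ⟨hr4 _ _ hw3, hw4⟩
    · rw [htest] at ht
      apply Runs.skip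
      refine ⟨hI2, fun _ _ h => h, fun a' b' ha' hb' hl => ?_⟩
      obtain rfl := Fin.ext ha'
      obtain rfl := Fin.ext hb'
      exact absurd hl ht
  · rintro m' - ⟨h3, -, h4⟩ u v
    have hiff : m'.nats 2 u v = 1 ↔ H.graph.Adj u v := by
      refine ⟨fun huv => (h3 u v huv).1, ?_⟩
      rintro ⟨-, a, b, hl, ⟨rfl, rfl⟩ | ⟨rfl, rfl⟩⟩
      · exact (h4 a a.2 _ (Fin.is_lt _) a _ rfl rfl hl).1
      · exact (h4 a a.2 _ (Fin.is_lt _) a _ rfl rfl hl).2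
    exact ⟨hiff, fun h => (h3 u v (hiff.2 h)).2⟩

end RealRAM

/-! ### The whole program and the theorem -/

namespace RealRAM

/-- Compute shortest path distances, net radii and representatives, and write the link graph. -/
def spannerProg : Prog :=
  .seq sumProg (.seq initDistProg (.seq relaxProg (.seq greedyProg (.seq repProg outputProg))))

theorem inputMem_reals_one {n : ℕ} (G : LengthGraph (Fin n)) (ε : ℝ) (u v : Fin n) :
    (inputMem G ε).reals 1 u v = G.weight u v := by
  simp only [inputMem, LengthGraph.weight, one_ne_zero, false_and, if_false]
  by_cases h : G.graph.Adj u v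
  · rw [dif_pos ⟨rfl, u.2, v.2, h⟩, if_pos h]
  · rw [dif_neg fun h' => h h'.2.choose_spec.choose_spec, if_neg h]

theorem inputMem_nats_one {n : ℕ} (G : LengthGraph (Fin n)) (ε : ℝ) (u v : Fin n) :
    0 < (inputMem G ε).nats 1 u v ↔ G.graph.Adj u v := by
  simp only [inputMem, one_ne_zero, false_and, if_false]
  by_cases h : G.graph.Adj u v
  · rw [if_pos ⟨rfl, u.2, v.2, h⟩]
    simp [h]
  · rw [if_neg fun h' => h h'.2.choose_spec.choose_spec]
    simp [h]

/-- The conclusion retains exactly what the geometric part needs: some net radii and some admissible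
choice of representatives, however they were found. -/
theorem runs_spannerProg {n : ℕ} {G : LengthGraph (Fin n)} {ε : ℝ}
    (hG : G.graph.Connected) (h0 : 0 < ε) (h1 : ε ≤ 1 / 2) :
    Runs n spannerProg (inputMem G ε) fun m =>
      ∃ (R : Fin n → ℝ) (B : ℝ) (rep : Fin n → Fin n → Fin n),
        IsNetRadius G.dist R B ∧ (∀ u v, G.dist u v ≤ B) ∧
        (∀ a b, Linked G.dist R (100 / ε) a b → IsRep G.dist R (100 / ε) a b (rep a b)) ∧
        HoldsOutput m (linkGraph (LengthGraph.isPseudoDist_dist hG) R (100 / ε) rep) := by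
  have hd := LengthGraph.isPseudoDist_dist hG
  have hpos : 0 < n := Fin.pos_iff_nonempty.2 hG.nonempty
  have hT : 1 ≤ 100 / ε := by rw [le_div_iff₀ h0]; linarith
  have hn0 : (inputMem G ε).nats 0 0 0 = n := by simp [inputMem]
  refine Runs.seq ((runs_sumProg hn0 (by simp [inputMem])).mono fun m1 _ hs hF1 => ?_)
  set B := m1.reals 6 0 0 with hB
  have hBsum : B = ∑ u, ∑ v, G.weight u v := by
    rw [hs, ← Fin.sum_univ_eq_sum_range (fun i => ∑ j ∈ Finset.range n, (inputMem G ε).reals 1 i j)]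
    refine Finset.sum_congr rfl fun u _ => ?_
    rw [← Fin.sum_univ_eq_sum_range (fun j => (inputMem G ε).reals 1 u j)]
    exact Finset.sum_congr rfl fun v _ => inputMem_reals_one G ε u v
  have hdB : ∀ u v, G.dist u v ≤ B := fun u v => by
    rw [hBsum]; exact LengthGraph.dist_le_sum_weight hG u v
  have hn1 : m1.nats 0 0 0 = n := by rw [hF1.nats 0 (by decide), hn0]
  refine Runs.seq ((runs_initDistProg (G := G) hn1 ?_ ?_ hdB).mono fun m2 _ hinit hF2 => ?_)
  · intro u v
    rw [hF1.nats 1 (by decide)]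
    exact inputMem_nats_one G ε u v
  · intro u v huv
    rw [hF1.reals 1 (by decide), inputMem_reals_one, LengthGraph.len_eq_weight huv]
  have hn2 : m2.nats 0 0 0 = n := by rw [hF2.nats 0 (by decide), hn1]
  refine Runs.seq ((runs_relaxProg hn2 hG hinit).mono fun m3 _ hD hF3 => ?_)
  have hn3 : m3.nats 0 0 0 = n := by rw [hF3.nats 0 (by decide), hn2]
  have hB3 : m3.reals 6 0 0 = B := by
    rw [hF3.reals 6 (by decide), hF2.reals 6 (by decide)]
  refine Runs.seq ((runs_greedyProg hn3 hpos hd hD ?_ ?_).mono fun m4 _ hR hF4 => ?_)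
  · rw [hB3, hBsum]
    exact Finset.sum_nonneg fun u _ => Finset.sum_nonneg fun v _ => LengthGraph.weight_nonneg u v
  · intro v
    rw [hF3.reals 5 (by decide), hF2.reals 5 (by decide), hF1.reals 5 (by decide)]
    simp [inputMem]
  rw [hB3] at hR
  have hnet : HoldsNet G.dist (fun v : Fin n => m4.reals 5 v 0) (100 / ε) m4 := by
    refine ⟨by rw [hF4.nats 0 (by decide), hn3], ?_, fun v => rfl, ?_⟩
    · rw [hF4.reals 3 (by decide)]
      exact hD
    · rw [hF4.reals 0 (by decide), hF3.reals 0 (by decide), hF2.reals 0 (by decide),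
        hF1.reals 0 (by decide)]
      simp [inputMem]
  refine Runs.seq ((runs_repProg hnet).mono fun m5 _ hrep hF5 => ?_)
  choose rep hrep5 hrepI using hrep
  have hnet5 := hnet.of_frame hF5 (by decide) (by decide) (by decide) (by decide)
  refine (runs_outputProg hnet5 hd hrep5
    (fun a b hl => (hrepI a b).ne hR.nonneg hT hl) ?_).mono fun m6 _ hout =>
      ⟨_, B, rep, hR, hdB, fun a b _ => hrepI a b, hout⟩
  intro u v
  rw [hF5.nats 2 (by decide), hF4.nats 2 (by decide), hF3.nats 2 (by decide),
    hF2.nats 2 (by decide), hF1.nats 2 (by decide)]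
  simp [inputMem]

end RealRAM

theorem theorem1 :
    ∃ (P : RealRAM.Prog) (p : Polynomial ℕ) (C : ℝ),
      ∀ (n : ℕ) (G : LengthGraph (Fin n)) (ε : ℝ),
        G.graph.Connected → 0 < ε → ε ≤ 1 / 2 →
        ∃ (t : ℕ) (m : RealRAM.Mem) (G' : LengthGraph (Fin n)),
          RealRAM.Exec P (RealRAM.inputMem G ε) t m ∧
          t ≤ p.eval n ∧
          RealRAM.HoldsOutput m G' ∧
          G'.graph.Connected ∧
          (∀ u v : Fin n,
            G.dist u v ≤ G'.dist u v ∧ G'.dist u v ≤ (1 + ε) * G.dist u v) ∧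
          ∀ k : ℝ, doublingDim G.dist = (k : EReal) →
            doublingDim G'.dist ≤ ((C * k : ℝ) : EReal) ∧
            doublingDim G'.convDist ≤ ((C * k * Real.logb 2 (1 / ε) : ℝ) : EReal) := by
  refine ⟨RealRAM.spannerProg, RealRAM.spannerProg.timePoly, 57, fun n G ε hG h0 h1 => ?_⟩
  obtain ⟨t, m, he, ht, R, B, rep, hR, hB, hrep, hout⟩ := RealRAM.runs_spannerProg hG h0 h1
  have hd := LengthGraph.isPseudoDist_dist hG
  have hT : 200 ≤ 100 / ε := by rw [le_div_iff₀ h0]; linarith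
  have hne : Nonempty (Fin n) := hG.nonempty
  refine ⟨t, m, _, he, ht, hout, linkGraph_connected hd hR hB hT hrep, fun u v =>
    ⟨le_dist_linkGraph hd hR hB hT hrep u v, ?_⟩, fun k hk =>
    doublingDim_linkGraph_le hd hR hB h0 h1 hrep hk⟩
  have := dist_linkGraph_le hd hR hB hT hrep u v
  rwa [div_div_cancel₀ (by norm_num : (100 : ℝ) ≠ 0)] at this
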